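/- Let $n\ge 0$ and $V=\{0,\dots,n-1\}$. A general partition matroid on $V$ is given by a partition $V=P_1\sqcup\dots\sqcup P_k$ into nonempty parts together with integers $r_1,\dots,r_k$ with $1\le r_i<|P_i|$. Its rank function is $\mathsf{rank}(S)=\sum_{i=1}^k\min(|S\cap P_i|,r_i)$ for $S\subseteq V$. Its rank is $r:=\mathsf{rank}(V)=\sum_{i=1}^k r_i$. A deterministic query algorithm is a rule which, from $n$ and the list of answers to the queries asked so far, determines either the next set $S$ to be queried (which is answered by $\mathsf{rank}(S)$), or the final output, upon which the algorithm halts. It is initially given only $n$; the parts $P_i$, their number $k$ and the integers $r_i$ are unknown to it. Theorem. There are a deterministic query algorithm whose rule is a computable function (a single one for all $n$) and an absolute constant $C$ such that, for every $n$ and every general partition matroid on $V$, the algorithm halts after at most $C\,(n+k\log_2 r)$ rank queries (with the convention $\log_2 0=0$ for the trivial case $n=0$) and outputs the matroid exactly, that is, the list (in some order) of all parts $P_i$, each with its number $r_i$. -/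

import Mathlib

/-- A general partition matroid on the finite ground set `V`: a partition of `V` into nonempty
parts, together with a capacity for each part that is positive and smaller than the size of the
part. The values of `cap` on sets that are not parts play no role. -/
structure GenPartitionMatroid {α : Type*} [DecidableEq α] (V : Finset α) where
  /-- The partition of the ground set. -/
  partition : Finpartition V
  /-- The capacity of each part. -/
  cap : Finset α → ℕ
  one_le_cap : ∀ P ∈ partition.parts, 1 ≤ cap P
  cap_lt_card : ∀ P ∈ partition.parts, cap P < P.card

namespace GenPartitionMatroid

variable {α : Type*} [DecidableEq α] {V : Finset α}

/-- The rank oracle: the sum over the parts `P` of `min |S ∩ P| (cap P)`. -/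
def rank (M : GenPartitionMatroid V) (S : Finset α) : ℕ :=
  ∑ P ∈ M.partition.parts, min (S ∩ P).card (M.cap P)

/-- The number `k` of parts. -/
def numParts (M : GenPartitionMatroid V) : ℕ :=
  M.partition.parts.card

/-- The rank of the whole ground set is the sum of the capacities. -/
theorem rank_ground (M : GenPartitionMatroid V) :
    M.rank V = ∑ P ∈ M.partition.parts, M.cap P := by
  refine Finset.sum_congr rfl fun P hP => ?_
  rw [Finset.inter_eq_right.mpr (M.partition.le hP)]
  exact min_eq_right (M.cap_lt_card P hP).le

end GenPartitionMatroid

/-- What a learning algorithm outputs: a list of parts (each one a list of elements), each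
together with its capacity. -/
abbrev LearnerOutput : Type := List (List ℕ × ℕ)

/-- A deterministic adaptive query algorithm. The ground set is `{0, …, n - 1}`. From `n` and the
list of the oracle's answers so far (in the order of the queries), the algorithm determines its
next move: `Sum.inl q` queries the set of the elements of `q`, and `Sum.inr o` halts with
output `o`. -/
abbrev QueryAlgorithm : Type := ℕ × List ℕ → List ℕ ⊕ LearnerOutput

/-- `A.RunsTo n oracle h m o`: on a ground set of size `n`, continuing from the list `h` of answers
received so far, the algorithm `A` halts with output `o` after exactly `m` further queries to
`oracle`. -/
inductive QueryAlgorithm.RunsTo (A : QueryAlgorithm) (n : ℕ) (oracle : Finset ℕ → ℕ) :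
    List ℕ → ℕ → LearnerOutput → Prop
  | halt (h : List ℕ) (o : LearnerOutput) (hA : A (n, h) = Sum.inr o) :
      QueryAlgorithm.RunsTo A n oracle h 0 o
  | query (h q : List ℕ) (m : ℕ) (o : LearnerOutput) (hA : A (n, h) = Sum.inl q)
      (hrun : QueryAlgorithm.RunsTo A n oracle (h ++ [oracle q.toFinset]) m o) :
      QueryAlgorithm.RunsTo A n oracle h (m + 1) o

/-- The output `o` lists every part of the partition of `M` exactly once, with its capacity, and
nothing else. -/
def LearnerOutput.Describes (o : LearnerOutput) {V : Finset ℕ} (M : GenPartitionMatroid V) : Prop :=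
  Multiset.map (fun x : List ℕ × ℕ => (x.1.toFinset, x.2)) (o : Multiset (List ℕ × ℕ)) =
    Multiset.map (fun P : Finset ℕ => (P, M.cap P)) M.partition.parts.val

/-! Prefix queries find the greedy basis `B`, which meets every part `P_i` in exactly `r_i`
elements; let `E` be its complement. For `X ⊆ B` and `Y ⊆ E`, the rank of `(B \ X) ∪ Y` is `|B| -
|X|` plus the sum over `i` of `min |X ∩ P_i| |Y ∩ P_i|` (`rank_exchange`), so one query yields this
overlap. Since `1 ≤ r_i < |P_i|`, every part meets both `B` and `E`.

When `E` is scanned, one query tells whether an element opens a new part; only then is a partner in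
`B` sought by binary search, at a cost of about `log r` (`learnable_transversal`). This is the
source of `n + k log r`. Overlaps with one side of the resulting transversal count the parts met by
any subset of the other side.

It remains to learn a partition of a set `W` with `O(|W|)` queries that count the classes met by a
subset (`CountsLabels.learns_ker`). This is done by merging blocks of size `2 ^ 2 ^ j`, recursively
in `j`. When a block is merged into the rest, Cantor–Mills coin weighing tells which of its class
representatives repeat an old class, with `O(m / log m)` queries for block size `m`; per element,
these costs form a geometric series over the levels. The old partner of each repeat is then found
one binary digit at a time, again by coin weighing. The number of digits is at most a constant times
the logarithm of the number of coins, so a repeat costs `O(1)` queries; every repeat lowers the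
number of classes, so there are at most `|W|` of them.

All this gives decision trees chosen classically. For fixed `n`, finitely many worlds suffice, so a
tree can be replaced by a finite table. Correctness of a table, including its query bound, is
primitive recursive, and an unbounded search that asks no queries gives one computable rule for all
`n`. -/

open Finset

/-! ### Decision trees and learnability -/

/-- A decision tree asking queries that are finite sets of naturals, with results in `α`. -/
inductive QueryTree (α : Type) : Type
  | pure (a : α) : QueryTree α
  | query (S : Finset ℕ) (k : ℕ → QueryTree α) : QueryTree α

namespace QueryTree

variable {α β : Type}

/-- The result of a decision tree on an oracle. -/
def run (o : Finset ℕ → ℕ) : QueryTree α → α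
  | pure a => a
  | query S k => run o (k (o S))

/-- The number of queries asked by a decision tree on an oracle. -/
def cost (o : Finset ℕ → ℕ) : QueryTree α → ℕ
  | pure _ => 0
  | query S k => cost o (k (o S)) + 1

/-- Continue with the tree `f a` at every leaf with result `a`. -/
def bind (f : α → QueryTree β) : QueryTree α → QueryTree β
  | pure a => f a
  | query S k => query S fun x => bind f (k x)

theorem run_bind (o : Finset ℕ → ℕ) (f : α → QueryTree β) (t : QueryTree α) :
    (t.bind f).run o = (f (t.run o)).run o := by
  induction t with
  | pure a => rfl
  | query S k ih => exact ih _

theorem cost_bind (o : Finset ℕ → ℕ) (f : α → QueryTree β) (t : QueryTree α) :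
    (t.bind f).cost o = t.cost o + (f (t.run o)).cost o := by
  induction t with
  | pure a => simp [bind, cost, run]
  | query S k ih => simp only [bind, cost, run, ih]; omega

end QueryTree

/-- With the oracles `orc ω`, some decision tree produces for all worlds `ω ∈ S` a result that
satisfies `post ω`, at a cost of at most `c ω` queries. -/
def Learnable {Ω α : Type} (orc : Ω → Finset ℕ → ℕ) (S : Set Ω) (c : Ω → ℝ)
    (post : Ω → α → Prop) : Prop :=
  ∃ t : QueryTree α, ∀ ω ∈ S, post ω (t.run (orc ω)) ∧ (t.cost (orc ω) : ℝ) ≤ c ω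

/-- The function `g` of the world can be computed with at most `c ω` queries. -/
abbrev Learns {Ω α : Type} (orc : Ω → Finset ℕ → ℕ) (S : Set Ω) (c : Ω → ℝ) (g : Ω → α) : Prop :=
  Learnable orc S c fun ω a => a = g ω

section Learnable

variable {Ω α β : Type} {orc : Ω → Finset ℕ → ℕ} {S S' : Set Ω} {c c' : Ω → ℝ}

theorem Learnable.mono {post post' : Ω → α → Prop} (h : Learnable orc S c post) (hS : S' ⊆ S)
    (hc : ∀ ω ∈ S', c ω ≤ c' ω) (hp : ∀ ω ∈ S', ∀ a, post ω a → post' ω a) :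
    Learnable orc S' c' post' := by
  obtain ⟨t, ht⟩ := h
  exact ⟨t, fun ω hω => ⟨hp ω hω _ (ht ω (hS hω)).1, (ht ω (hS hω)).2.trans (hc ω hω)⟩⟩

theorem Learnable.mono_set {post : Ω → α → Prop} (h : Learnable orc S c post) (hS : S' ⊆ S) :
    Learnable orc S' c post :=
  h.mono hS (fun _ _ => le_rfl) fun _ _ _ => id

theorem Learnable.mono_cost {post : Ω → α → Prop} (h : Learnable orc S c post)
    (hc : ∀ ω ∈ S, c ω ≤ c' ω) : Learnable orc S c' post :=
  h.mono subset_rfl hc fun _ _ _ => id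

theorem Learnable.congr {g g' : Ω → α} (h : Learns orc S c g) (hg : ∀ ω ∈ S, g ω = g' ω) :
    Learns orc S c g' :=
  h.mono subset_rfl (fun _ _ => le_rfl) fun ω hω _ ha => ha.trans (hg ω hω)

theorem learnable_pure {post : Ω → α → Prop} (a : α) (h : ∀ ω ∈ S, post ω a)
    (hc : ∀ ω ∈ S, 0 ≤ c ω) : Learnable orc S c post :=
  ⟨.pure a, fun ω hω => ⟨h ω hω, by simpa [QueryTree.cost] using hc ω hω⟩⟩

theorem learns_of_const [Nonempty α] {g : Ω → α} (h : ∀ ω ∈ S, ∀ ω' ∈ S, g ω = g ω')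
    (hc : ∀ ω ∈ S, 0 ≤ c ω) : Learns orc S c g := by
  rcases S.eq_empty_or_nonempty with rfl | ⟨ω₀, hω₀⟩
  · exact learnable_pure (Classical.arbitrary α) (by simp) (by simp)
  · exact learnable_pure (g ω₀) (fun ω hω => h _ hω₀ _ hω) hc

theorem learns_query (Q : Finset ℕ) : Learns orc S (fun _ => 1) fun ω => orc ω Q :=
  ⟨.query Q .pure, fun ω _ => by simp [QueryTree.run, QueryTree.cost]⟩

/-- The second stage may use that the first result is correct, which shrinks the set of possible
worlds. Its cost depends on the unknown world rather than on the result, which permits amortized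
bounds. -/
theorem Learnable.bind {post : Ω → α → Prop} {post' : Ω → β → Prop}
    (h : Learnable orc S c post)
    (h' : ∀ a, Learnable orc {ω | ω ∈ S ∧ post ω a} c' post') :
    Learnable orc S (fun ω => c ω + c' ω) post' := by
  obtain ⟨t, ht⟩ := h
  choose u hu using h'
  refine ⟨t.bind u, fun ω hω => ?_⟩
  have h1 := ht ω hω
  have h2 := hu (t.run (orc ω)) ω ⟨hω, h1.1⟩
  rw [QueryTree.run_bind, QueryTree.cost_bind]
  refine ⟨h2.1, ?_⟩
  push_cast
  linarith [h1.2, h2.2]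

/-- Only information counts: once `g ω` is known, anything constant on its fibres is free. -/
theorem Learnable.determines [Nonempty β] {g : Ω → α} {g' : Ω → β} (h : Learns orc S c g)
    (hg : ∀ ω ∈ S, ∀ ω' ∈ S, g ω = g ω' → g' ω = g' ω') : Learns orc S c g' := by
  refine (h.bind (c' := fun _ => 0) fun a => learns_of_const ?_ (by simp)).mono_cost (by simp)
  rintro ω ⟨hω, rfl⟩ ω' ⟨hω', h'⟩
  exact hg _ hω _ hω' h'

theorem learns_finset {ι : Type} [DecidableEq ι] (I : Finset ι) (q : ι → Ω → ℕ)
    (h : ∀ i ∈ I, Learns orc S (fun _ => 1) (q i)) :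
    Learns orc S (fun _ => (#I : ℝ)) fun ω i => if i ∈ I then q i ω else 0 := by
  induction I using Finset.induction_on with
  | empty => exact learns_of_const (by simp) (by simp)
  | insert i I hi ih =>
    refine ((ih fun j hj => h j (mem_insert_of_mem hj)).bind (c' := fun _ => 1) fun a =>
      ((h i (mem_insert_self i I)).mono_set (Set.sep_subset S _)).determines ?_).mono_cost ?_
    · rintro ω ⟨hω, rfl⟩ ω' ⟨hω', h'⟩ hq
      funext j
      have := congrFun h' j
      simp only [mem_insert]
      by_cases hj : j = i
      · simp [hj, hq]
      · simpa [hj] using this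
    · simp [hi]

end Learnable

/-! ### Coin weighing -/

/-- Sums of coins in `D` over `q` fixed subsets identify every subset of `D`, as soon as `D` has at
most `m` elements. -/
def CoinWeighing (q m : ℕ) : Prop :=
  ∀ D : Finset ℕ, #D ≤ m → ∃ Q : Fin q → Finset ℕ, (∀ i, Q i ⊆ D) ∧
    ∀ x ⊆ D, ∀ y ⊆ D, (∀ i, #(Q i ∩ x) = #(Q i ∩ y)) → x = y

theorem CoinWeighing.of_index {ι : Type} [Fintype ι] {q : ℕ} (hq : Fintype.card ι = q)
    {D : Finset ℕ}
    (h : ∃ Q : ι → Finset ℕ, (∀ i, Q i ⊆ D) ∧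
      ∀ x ⊆ D, ∀ y ⊆ D, (∀ i, #(Q i ∩ x) = #(Q i ∩ y)) → x = y) :
    ∃ Q : Fin q → Finset ℕ, (∀ i, Q i ⊆ D) ∧
      ∀ x ⊆ D, ∀ y ⊆ D, (∀ i, #(Q i ∩ x) = #(Q i ∩ y)) → x = y := by
  obtain ⟨Q, hQ, h⟩ := h
  let e := Fintype.equivFinOfCardEq hq
  refine ⟨fun i => Q (e.symm i), fun i => hQ _, fun x hx y hy hxy => h x hx y hy fun i => ?_⟩
  simpa using hxy (e i)

theorem coinWeighing_one : CoinWeighing 1 1 := by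
  intro D hD
  refine ⟨fun _ => D, fun _ => subset_rfl, fun x hx y hy h => ?_⟩
  have h0 := h 0
  rw [inter_eq_right.2 hx, inter_eq_right.2 hy] at h0
  rcases Nat.le_one_iff_eq_zero_or_eq_one.1 (hD.trans' (card_le_card hx)) with h1 | h1
  · rw [h1] at h0
    rw [card_eq_zero.1 h1, card_eq_zero.1 h0.symm]
  · rw [eq_of_subset_of_card_le hx (by omega), eq_of_subset_of_card_le hy (by omega)]

/-- The recursive step of the construction of Cantor and Mills. -/
theorem CoinWeighing.step {q m : ℕ} (h : CoinWeighing q m) :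
    CoinWeighing (2 * q + 1) (2 * m + q) := by
  intro D hD
  obtain ⟨U, hUD, hU⟩ := exists_subset_card_eq (min_le_left #D m)
  obtain ⟨V, hVD, hV⟩ := exists_subset_card_eq (min_le_left #(D \ U) m)
  have hDU := card_sdiff_add_card_eq_card hUD
  have hDV := card_sdiff_add_card_eq_card hVD
  set W := (D \ U) \ V with hW
  have hWq : #W ≤ q := by omega
  obtain ⟨QU, hQU, hU'⟩ := h U (by omega)
  obtain ⟨QV, hQV, hV'⟩ := h V (by omega)
  let e : ℕ → ℕ := fun x => if hx : x ∈ W then (W.equivFin ⟨x, hx⟩ : ℕ) else 0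
  have he : Set.InjOn e W := by
    intro x hx y hy hxy
    simp only [e, dif_pos (mem_coe.1 hx), dif_pos (mem_coe.1 hy)] at hxy
    simpa using W.equivFin.injective (Fin.ext hxy)
  have heq : ∀ x ∈ W, e x < q := by
    intro x hx
    simp only [e, dif_pos hx]
    omega
  let w : Fin q → Finset ℕ := fun i => W.filter fun x => e x = i
  have hw : ∀ i, #(w i) ≤ 1 := by
    intro i
    refine card_le_one.2 fun x hx y hy => ?_
    simp only [w, mem_filter] at hx hy
    exact he hx.1 hy.1 (hx.2.trans hy.2.symm)
  have hwW : ∀ i, w i ⊆ W := fun i => filter_subset _ _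
  have hWD : W ⊆ D := sdiff_subset.trans sdiff_subset
  have hVD' : V ⊆ D := hVD.trans sdiff_subset
  have dUV : Disjoint U V := disjoint_left.2 fun x hx hx' => (mem_sdiff.1 (hVD hx')).2 hx
  have dUW : Disjoint U W :=
    disjoint_left.2 fun x hx hx' => (mem_sdiff.1 (mem_sdiff.1 hx').1).2 hx
  have dVW : Disjoint V W := disjoint_left.2 fun x hx hx' => (mem_sdiff.1 hx').2 hx
  -- The weighings are `QU ∪ QV ∪ w`, `QU ∪ (V \ QV)` and `V`, where each `w i` holds at most one
  -- additional coin.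
  refine CoinWeighing.of_index (ι := (Fin q ⊕ Fin q) ⊕ Unit) (by simp; ring)
    ⟨Sum.elim (Sum.elim (fun i => (QU i ∪ QV i) ∪ w i) fun i => QU i ∪ (V \ QV i)) fun _ => V,
      ?_, ?_⟩
  · rintro ((i | i) | _)
    · exact union_subset (union_subset ((hQU i).trans hUD) ((hQV i).trans hVD'))
        ((hwW i).trans hWD)
    · exact union_subset ((hQU i).trans hUD) (sdiff_subset.trans hVD')
    · exact hVD'
  · intro x hx y hy hxy
    have c1 : ∀ i z, #(((QU i ∪ QV i) ∪ w i) ∩ z) = #(QU i ∩ z) + #(QV i ∩ z) + #(w i ∩ z) := by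
      intro i z
      rw [union_inter_distrib_right, card_union_of_disjoint, union_inter_distrib_right,
        card_union_of_disjoint]
      · exact dUV.mono (inter_subset_left.trans (hQU i)) (inter_subset_left.trans (hQV i))
      · exact (disjoint_union_left.2 ⟨dUW, dVW⟩).mono
          (inter_subset_left.trans (union_subset_union (hQU i) (hQV i)))
          (inter_subset_left.trans (hwW i))
    have c2 : ∀ i z, #((QU i ∪ (V \ QV i)) ∩ z) + #(QV i ∩ z) = #(QU i ∩ z) + #(V ∩ z) := by
      intro i z
      rw [union_inter_distrib_right, card_union_of_disjoint, add_assoc, ← card_union_of_disjoint,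
        ← union_inter_distrib_right, sdiff_union_of_subset (hQV i)]
      · exact sdiff_disjoint.mono inter_subset_left inter_subset_left
      · exact dUV.mono (inter_subset_left.trans (hQU i)) (inter_subset_left.trans sdiff_subset)
    have hVxy : #(V ∩ x) = #(V ∩ y) := hxy (Sum.inr ())
    have key : ∀ i, #(QU i ∩ x) = #(QU i ∩ y) ∧ #(QV i ∩ x) = #(QV i ∩ y) ∧
        #(w i ∩ x) = #(w i ∩ y) := by
      intro i
      have e1 : #(((QU i ∪ QV i) ∪ w i) ∩ x) = #(((QU i ∪ QV i) ∪ w i) ∩ y) :=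
        hxy (Sum.inl (Sum.inl i))
      have e2 : #((QU i ∪ (V \ QV i)) ∩ x) = #((QU i ∪ (V \ QV i)) ∩ y) :=
        hxy (Sum.inl (Sum.inr i))
      have a1 := c2 i x
      have a2 := c2 i y
      rw [c1, c1] at e1
      have b1 := (card_le_card (inter_subset_left (s₁ := w i) (s₂ := x))).trans (hw i)
      have b2 := (card_le_card (inter_subset_left (s₁ := w i) (s₂ := y))).trans (hw i)
      -- The first two weighings add up to `2 * #(QU i ∩ x) + #(w i ∩ x) + #(V ∩ x)`. As `#(V ∩ x)`
      -- is known, parity gives the additional coin, and then the other two counts follow.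
      omega
    have eU : U ∩ x = U ∩ y := by
      refine hU' _ inter_subset_left _ inter_subset_left fun i => ?_
      rw [← inter_assoc, ← inter_assoc, inter_eq_left.2 (hQU i)]
      exact (key i).1
    have eV : V ∩ x = V ∩ y := by
      refine hV' _ inter_subset_left _ inter_subset_left fun i => ?_
      rw [← inter_assoc, ← inter_assoc, inter_eq_left.2 (hQV i)]
      exact (key i).2.1
    have eW : ∀ z ∈ W, ∀ s t : Finset ℕ, (∀ i, #(w i ∩ s) = #(w i ∩ t)) → z ∈ s → z ∈ t := by
      intro z hz s t hst hzs
      have hzw : z ∈ w ⟨e z, heq z hz⟩ := mem_filter.2 ⟨hz, rfl⟩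
      have hpos : 0 < #(w ⟨e z, heq z hz⟩ ∩ t) := by
        rw [← hst]
        exact card_pos.2 ⟨z, mem_inter.2 ⟨hzw, hzs⟩⟩
      obtain ⟨z', hz'⟩ := card_pos.1 hpos
      have := card_le_one.1 (hw _) z hzw z' (mem_inter.1 hz').1
      exact this ▸ (mem_inter.1 hz').2
    ext z
    have hUVW : z ∈ D → z ∈ U ∨ z ∈ V ∨ z ∈ W := by
      intro hz
      simp only [hW, mem_sdiff]
      tauto
    have hzU := Finset.ext_iff.1 eU z
    have hzV := Finset.ext_iff.1 eV z
    simp only [mem_inter] at hzU hzV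
    constructor
    · intro hz
      rcases hUVW (hx hz) with hz' | hz' | hz'
      · tauto
      · tauto
      · exact eW z hz' x y (fun i => (key i).2.2) hz
    · intro hz
      rcases hUVW (hy hz) with hz' | hz' | hz'
      · tauto
      · tauto
      · exact eW z hz' y x (fun i => (key i).2.2.symm) hz

theorem exists_coinWeighing (j : ℕ) :
    ∃ q, q + 1 = 2 ^ (j + 1) ∧ CoinWeighing q (j * 2 ^ j + 1) := by
  induction j with
  | zero => exact ⟨1, by norm_num, by simpa using coinWeighing_one⟩
  | succ j ih =>
    obtain ⟨q, hq, h⟩ := ih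
    refine ⟨2 * q + 1, by rw [pow_succ]; omega, ?_⟩
    convert h.step using 1
    have : q = 2 ^ (j + 1) - 1 := by omega
    subst this
    have := Nat.one_le_two_pow (n := j + 1)
    zify [this]
    ring

/-- Coin weighing of `N` coins with about `4 N / log N` queries. The bound `N = 2 ^ 2 ^ j` makes the
logarithm the exact power `2 ^ j`. -/
theorem learns_subset {Ω : Type} {orc : Ω → Finset ℕ → ℕ} {S : Set Ω} {D : Finset ℕ}
    {x : Ω → Finset ℕ} (hx : ∀ ω ∈ S, x ω ⊆ D)
    (h : ∀ Y ⊆ D, Learns orc S (fun _ => 1) fun ω => #(Y ∩ x ω)) {j : ℕ}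
    (hD : #D ≤ 2 ^ 2 ^ j) : Learns orc S (fun _ => 4 * 2 ^ 2 ^ j / 2 ^ j) x := by
  have hj : j ≤ 2 ^ j := Nat.lt_two_pow_self.le
  -- With exponent `e = 2 ^ j - j + 1` the capacity `e * 2 ^ e + 1` reaches `2 ^ 2 ^ j` because `2 ^
  -- j ≤ 2 * e`, while `q + 1 = 2 ^ (e + 1)` is the claimed cost.
  obtain ⟨q, hq, hw⟩ := exists_coinWeighing (2 ^ j - j + 1)
  obtain ⟨Q, hQD, hQ⟩ := hw D <| by
    refine hD.trans (Nat.le_succ_of_le ?_)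
    obtain ⟨d, hd⟩ := Nat.exists_eq_add_of_le hj
    have h2 : 2 ^ j ≤ 2 * (d + 1) := by
      rcases j with _ | _ | j
      · omega
      · omega
      · have := Nat.lt_two_pow_self (n := j + 1)
        rw [pow_succ] at *
        omega
    have hd' : 2 ^ j - j + 1 = d + 1 := by omega
    rw [hd']
    calc 2 ^ 2 ^ j = 2 ^ j * 2 ^ d := by rw [← pow_add, ← hd]
      _ ≤ (2 * (d + 1)) * 2 ^ d := Nat.mul_le_mul_right _ h2
      _ = (d + 1) * 2 ^ (d + 1) := by ring
  refine ((learns_finset univ (fun i ω => #(Q i ∩ x ω)) fun i _ => h _ (hQD i)).determines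
    (g' := x) ?_).mono_cost ?_
  · intro ω hω ω' hω' he
    exact hQ _ (hx ω hω) _ (hx ω' hω') fun i => by simpa using congrFun he i
  · intro ω _
    have h1 : (q : ℝ) + 1 = 2 ^ (2 ^ j - j + 1 + 1) := by exact_mod_cast hq
    have h2 : (2 : ℝ) ^ (2 ^ j - j + 1 + 1) = 4 * 2 ^ 2 ^ j / 2 ^ j := by
      rw [eq_div_iff (by positivity), ← pow_add]
      have : 2 ^ j - j + 1 + 1 + j = 2 ^ j + 2 := by omega
      rw [this, pow_add]
      ring
    simp only [card_univ, Fintype.card_fin]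
    linarith

/-! ### Learning a partition by counting classes -/

/-- The kernel of `f` on `W`, as a set of pairs. -/
def labelKer (f : ℕ → ℕ) (W : Finset ℕ) : Finset (ℕ × ℕ) :=
  (W ×ˢ W).filter fun p => f p.1 = f p.2

theorem mem_labelKer {f : ℕ → ℕ} {W : Finset ℕ} {x y : ℕ} :
    (x, y) ∈ labelKer f W ↔ (x ∈ W ∧ y ∈ W) ∧ f x = f y := by
  simp [labelKer]

theorem labelKer_eq_iff {f g : ℕ → ℕ} {W : Finset ℕ} :
    labelKer f W = labelKer g W ↔ ∀ x ∈ W, ∀ y ∈ W, (f x = f y ↔ g x = g y) := by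
  constructor
  · intro h x hx y hy
    have := Finset.ext_iff.1 h (x, y)
    simpa [mem_labelKer, hx, hy] using this
  · intro h
    ext ⟨x, y⟩
    simp only [mem_labelKer]
    exact and_congr_right fun hxy => h x hxy.1 y hxy.2

section

variable {Ω : Type} {orc : Ω → Finset ℕ → ℕ} {S S' : Set Ω} {f : Ω → ℕ → ℕ}

/-- The number of labels on a subset of `W` can be found with one query. -/
def CountsLabels (orc : Ω → Finset ℕ → ℕ) (S : Set Ω) (f : Ω → ℕ → ℕ) (W : Finset ℕ) : Prop :=
  ∀ Y ⊆ W, Learns orc S (fun _ => 1) fun ω => #(Y.image (f ω))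

theorem CountsLabels.mono {W W' : Finset ℕ} (h : CountsLabels orc S f W) (hS : S' ⊆ S)
    (hW : W' ⊆ W) : CountsLabels orc S' f W' :=
  fun Y hY => (h Y (hY.trans hW)).mono_set hS

theorem CountsLabels.learns_ker_sq {W : Finset ℕ} (h : CountsLabels orc S f W) :
    Learns orc S (fun _ => (#W : ℝ) ^ 2) fun ω => labelKer (f ω) W := by
  refine ((learns_finset (W ×ˢ W) (fun p ω => #(({p.1, p.2} : Finset ℕ).image (f ω))) ?_).determines
    (g' := fun ω => labelKer (f ω) W) ?_).mono_cost ?_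
  · rintro ⟨x, y⟩ hxy
    rw [mem_product] at hxy
    exact h _ (insert_subset hxy.1 (singleton_subset_iff.2 hxy.2))
  · intro ω _ ω' _ he
    refine labelKer_eq_iff.2 fun x hx y hy => ?_
    have h1 := congrFun he (x, y)
    simp only [mem_product, hx, hy, and_self, if_true, image_insert, image_singleton] at h1
    by_cases h2 : f ω x = f ω y <;> by_cases h3 : f ω' x = f ω' y <;>
      simp_all
  · intro ω _
    simp [card_product, sq]

/-- The code of the partner in `R` has `2 ^ (i + 2)` binary digits. For each digit, the elements of
`D` with digit 1 are found by coin weighing with `4 * 2 ^ 2 ^ i / 2 ^ i` queries; the product is `16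
* 2 ^ 2 ^ i`. -/
theorem learns_partners_block {R D : Finset ℕ} (hq : CountsLabels orc S f (R ∪ D)) {i : ℕ}
    (hR : #R ≤ 2 ^ 2 ^ (i + 2)) (hD : #D ≤ 2 ^ 2 ^ i)
    (injR : ∀ ω ∈ S, Set.InjOn (f ω) R) (injD : ∀ ω ∈ S, Set.InjOn (f ω) D)
    (hDR : ∀ ω ∈ S, D.image (f ω) ⊆ R.image (f ω)) :
    Learns orc S (fun _ => 16 * 2 ^ 2 ^ i)
      fun ω => (R ×ˢ D).filter fun p => f ω p.1 = f ω p.2 := by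
  let code : ℕ → ℕ := fun x => if hx : x ∈ R then (R.equivFin ⟨x, hx⟩ : ℕ) else 0
  have hcode : Set.InjOn code R := by
    intro x hx y hy hxy
    simp only [code, dif_pos (mem_coe.1 hx), dif_pos (mem_coe.1 hy)] at hxy
    simpa using R.equivFin.injective (Fin.ext hxy)
  have hlt : ∀ x, x ∈ R → code x < 2 ^ 2 ^ (i + 2) := by
    intro x hx
    simp only [code, dif_pos hx]
    omega
  let hi : ℕ → Finset ℕ := fun l => R.filter fun x => (code x).testBit l
  let bits : ℕ → Ω → Finset ℕ := fun l ω => D.filter fun y => f ω y ∈ (hi l).image (f ω)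
  have hbit : ∀ l, Learns orc S (fun _ => 4 * 2 ^ 2 ^ i / 2 ^ i) (bits l) := by
    intro l
    refine learns_subset (fun ω _ => filter_subset _ _) (fun Y hY => ?_) hD
    have hloR : R \ hi l ⊆ R := sdiff_subset
    -- Next to the representatives with digit 0, an element of `Y` contributes a new label exactly
    -- when the digit of its partner is 1.
    refine (hq ((R \ hi l) ∪ Y) (union_subset_union hloR hY)).determines ?_
    have count : ∀ ω ∈ S, #(((R \ hi l) ∪ Y).image (f ω)) = #(R \ hi l) + #(Y ∩ bits l ω) := by
      intro ω hω
      rw [image_union, ← card_image_of_injOn ((injR ω hω).mono (coe_subset.2 hloR)),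
        ← card_image_of_injOn ((injD ω hω).mono
          (coe_subset.2 (inter_subset_left.trans hY) : ((Y ∩ bits l ω : Finset ℕ) : Set ℕ) ⊆ D)),
        ← card_union_of_disjoint]
      · congr 1
        ext a
        simp only [mem_union, mem_image, mem_inter, bits, mem_filter]
        constructor
        · rintro (⟨x, hx, rfl⟩ | ⟨y, hy, rfl⟩)
          · exact Or.inl ⟨x, hx, rfl⟩
          · obtain ⟨x, hx, hxy⟩ := mem_image.1 (hDR ω hω (mem_image_of_mem _ (hY hy)))
            by_cases hxl : x ∈ hi l
            · exact Or.inr ⟨y, ⟨hy, hY hy, x, hxl, hxy⟩, rfl⟩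
            · exact Or.inl ⟨x, mem_sdiff.2 ⟨hx, hxl⟩, hxy⟩
        · rintro (⟨x, hx, rfl⟩ | ⟨y, hy, rfl⟩)
          · exact Or.inl ⟨x, hx, rfl⟩
          · exact Or.inr ⟨y, hy.1, rfl⟩
      · rw [disjoint_left]
        rintro a ha ha'
        obtain ⟨x, hx, rfl⟩ := mem_image.1 ha
        obtain ⟨y, hy, hxy⟩ := mem_image.1 ha'
        obtain ⟨x', hx', hxy'⟩ := mem_image.1 (mem_filter.1 (mem_inter.1 hy).2).2
        have := injR ω hω (mem_coe.2 (mem_filter.1 hx').1) (mem_coe.2 (hloR hx)) (hxy'.trans hxy)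
        exact (mem_sdiff.1 hx).2 (this ▸ hx')
    intro ω hω ω' hω' he
    rw [count ω hω, count ω' hω'] at he
    exact Nat.add_left_cancel he
  have hall : ∀ n : ℕ, Learns orc S (fun _ => n * (4 * 2 ^ 2 ^ i / 2 ^ i))
      fun ω l => if l < n then bits l ω else ∅ := by
    intro n
    induction n with
    | zero => exact learns_of_const (by simp) (by simp)
    | succ n ih =>
      refine (ih.bind (c' := fun _ => 4 * 2 ^ 2 ^ i / 2 ^ i) fun a =>
        ((hbit n).mono_set (Set.sep_subset S _)).determines ?_).mono_cost ?_
      · rintro ω ⟨hω, rfl⟩ ω' ⟨hω', h'⟩ hb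
        funext l
        have := congrFun h' l
        rcases lt_trichotomy l n with hl | rfl | hl
        · simpa [hl, Nat.lt_succ_of_lt hl] using this
        · simpa using hb
        · simp [show ¬ l < n + 1 by omega]
      · intro ω _
        push_cast
        linarith
  refine ((hall (2 ^ (i + 2))).determines ?_).mono_cost ?_
  · intro ω hω ω' hω' he
    have hb : ∀ l < 2 ^ (i + 2), bits l ω = bits l ω' := by
      intro l hl
      simpa [hl] using congrFun he l
    have half : ∀ ω ∈ S, ∀ ω' ∈ S, (∀ l < 2 ^ (i + 2), bits l ω = bits l ω') →
        ∀ x ∈ R, ∀ y ∈ D, f ω x = f ω y → f ω' x = f ω' y := by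
      intro ω hω ω' hω' hb x hx y hy hxy
      obtain ⟨x', hx', hxy'⟩ := mem_image.1 (hDR ω' hω' (mem_image_of_mem _ hy))
      have hbits : ∀ ω ∈ S, ∀ x ∈ R, f ω x = f ω y → ∀ l,
          (y ∈ bits l ω ↔ (code x).testBit l = true) := by
        intro ω hω x hx hxy l
        simp only [bits, hi, mem_filter, hy, true_and, mem_image]
        constructor
        · rintro ⟨z, ⟨hz, hzl⟩, hzy⟩
          exact injR ω hω (mem_coe.2 hz) (mem_coe.2 hx) (hzy.trans hxy.symm) ▸ hzl
        · exact fun hl => ⟨x, ⟨hx, hl⟩, hxy⟩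
      have hxx : code x = code x' := by
        refine Nat.eq_of_testBit_eq fun l => ?_
        by_cases hl : l < 2 ^ (i + 2)
        · rw [Bool.eq_iff_iff, ← hbits ω hω x hx hxy l, ← hbits ω' hω' x' hx' hxy' l, hb l hl]
        · have hp := Nat.pow_le_pow_right (n := 2) (by norm_num) (not_lt.1 hl)
          rw [Nat.testBit_lt_two_pow ((hlt x hx).trans_le hp),
            Nat.testBit_lt_two_pow ((hlt x' hx').trans_le hp)]
      rwa [hcode (mem_coe.2 hx) (mem_coe.2 hx') hxx]
    refine filter_congr fun p hp => ?_
    rw [mem_product] at hp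
    exact ⟨half ω hω ω' hω' hb _ hp.1 _ hp.2,
      half ω' hω' ω hω (fun l hl => (hb l hl).symm) _ hp.1 _ hp.2⟩
  · intro ω _
    push_cast
    rw [pow_add]
    apply le_of_eq
    field_simp
    norm_num

/-- Full blocks of `2 ^ 2 ^ i` elements cost 16 per element; the summand `2 ^ 2 ^ i` pays for the
last, incomplete block. -/
theorem learns_partners {R : Finset ℕ} {i : ℕ} (hR : #R ≤ 2 ^ 2 ^ (i + 2))
    (injR : ∀ ω ∈ S, Set.InjOn (f ω) R) (D : Finset ℕ) (hq : CountsLabels orc S f (R ∪ D))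
    (injD : ∀ ω ∈ S, Set.InjOn (f ω) D)
    (hDR : ∀ ω ∈ S, D.image (f ω) ⊆ R.image (f ω)) :
    Learns orc S (fun _ => 16 * (#D + 2 ^ 2 ^ i))
      fun ω => (R ×ˢ D).filter fun p => f ω p.1 = f ω p.2 := by
  induction hn : #D using Nat.strong_induction_on generalizing D with
  | _ n ih =>
    subst hn
    rcases le_total #D (2 ^ 2 ^ i) with hD | hD
    · refine (learns_partners_block hq hR hD injR injD hDR).mono_cost fun ω _ => ?_
      have : (0 : ℝ) ≤ #D := by positivity
      linarith
    · obtain ⟨D', hD', hc⟩ := exists_subset_card_eq hD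
      have hcard := card_sdiff_add_card_eq_card hD'
      have hpos : 0 < 2 ^ 2 ^ i := by positivity
      have hsd : D \ D' ⊆ D := sdiff_subset
      have h1 := learns_partners_block (hq.mono subset_rfl (union_subset_union_right hD')) hR hc.le
        injR (fun ω hω => (injD ω hω).mono (coe_subset.2 hD'))
        (fun ω hω => (image_subset_image hD').trans (hDR ω hω))
      have h2 := ih #(D \ D') (by omega) (D \ D')
        (hq.mono subset_rfl (union_subset_union_right hsd))
        (fun ω hω => (injD ω hω).mono (coe_subset.2 hsd))
        (fun ω hω => (image_subset_image hsd).trans (hDR ω hω)) rfl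
      refine (h1.bind fun a => (h2.mono_set (Set.sep_subset S _)).determines ?_).mono_cost ?_
      · rintro ω ⟨hω, rfl⟩ ω' ⟨hω', h'⟩ hb
        refine filter_congr fun p hp => ?_
        rw [mem_product] at hp
        by_cases hpD : p.2 ∈ D'
        · have := Finset.ext_iff.1 h' p
          simpa [hp.1, hpD] using this
        · have := Finset.ext_iff.1 hb p
          simpa [hp.1, hp.2, hpD] using this
      · intro ω _
        rw [← hcard, hc]
        push_cast
        linarith

theorem exists_representatives (g : ℕ → ℕ) (A : Finset ℕ) :
    ∃ R ⊆ A, Set.InjOn g R ∧ R.image g = A.image g := by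
  obtain ⟨R, hR, h⟩ := (Set.surjOn_image g (A : Set ℕ)).exists_bijOn_subset
  have hfin : R.Finite := A.finite_toSet.subset hR
  refine ⟨hfin.toFinset, by simpa using hR, by simpa using h.injOn, ?_⟩
  rw [← coe_inj]
  simpa using h.image_eq

/-- Representatives depend only on the kernel, so a choice made in one world serves all worlds with
the same kernel. -/
theorem representatives_of_ker {g g' : ℕ → ℕ} {A R : Finset ℕ} (hR : R ⊆ A)
    (hk : labelKer g A = labelKer g' A) (hinj : Set.InjOn g R) (him : R.image g = A.image g) :
    Set.InjOn g' R ∧ R.image g' = A.image g' := by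
  rw [labelKer_eq_iff] at hk
  refine ⟨fun x hx y hy hxy => hinj hx hy ((hk x (hR hx) y (hR hy)).2 hxy), ?_⟩
  refine (image_subset_image hR).antisymm fun a ha => ?_
  obtain ⟨x, hx, rfl⟩ := mem_image.1 ha
  obtain ⟨y, hy, hxy⟩ := mem_image.1 (him.symm ▸ mem_image_of_mem g hx)
  exact mem_image.2 ⟨y, hy, (hk y (hR hy) x hx).1 hxy⟩

theorem labelKer_union_eq {g g' : ℕ → ℕ} {A B RA RB : Finset ℕ} (hRA : RA ⊆ A) (hRB : RB ⊆ B)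
    (hA : labelKer g A = labelKer g' A) (hB : labelKer g B = labelKer g' B)
    (hiA : RA.image g = A.image g) (hiB : RB.image g = B.image g)
    (hAB : ∀ x ∈ RA, ∀ y ∈ RB, (g x = g y ↔ g' x = g' y)) :
    labelKer g (A ∪ B) = labelKer g' (A ∪ B) := by
  rw [labelKer_eq_iff] at *
  have cross : ∀ x ∈ A, ∀ y ∈ B, (g x = g y ↔ g' x = g' y) := by
    intro x hx y hy
    obtain ⟨x', hx', hxx⟩ := mem_image.1 (hiA.symm ▸ mem_image_of_mem g hx)
    obtain ⟨y', hy', hyy⟩ := mem_image.1 (hiB.symm ▸ mem_image_of_mem g hy)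
    rw [← hxx, ← hyy, hAB x' hx' y' hy', (hA x' (hRA hx') x hx).1 hxx,
      (hB y' (hRB hy') y hy).1 hyy]
  intro x hx y hy
  rcases mem_union.1 hx with hx | hx <;> rcases mem_union.1 hy with hy | hy
  · exact hA x hx y hy
  · exact cross x hx y hy
  · rw [eq_comm, cross y hy x hx, eq_comm]
  · exact hB x hx y hy

/-- Coin weighing first finds the set of representatives of `B` whose label occurs in `A`; only
these need partners. Their number is the difference of label counts in the cost. -/
theorem learns_ker_union {A B : Finset ℕ} {i : ℕ} (hq : CountsLabels orc S f (A ∪ B))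
    (hA : #A ≤ 2 ^ 2 ^ (i + 2)) (hB : #B ≤ 2 ^ 2 ^ (i + 1))
    (kA : ∀ ω ∈ S, ∀ ω' ∈ S, labelKer (f ω) A = labelKer (f ω') A)
    (kB : ∀ ω ∈ S, ∀ ω' ∈ S, labelKer (f ω) B = labelKer (f ω') B) :
    Learns orc S (fun ω => 36 * 2 ^ 2 ^ (i + 1) / 2 ^ (i + 1) +
        16 * (#(A.image (f ω)) + #(B.image (f ω)) - #((A ∪ B).image (f ω))))
      fun ω => labelKer (f ω) (A ∪ B) := by
  rcases S.eq_empty_or_nonempty with rfl | ⟨ω₀, hω₀⟩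
  · exact learns_of_const (by simp) (by simp)
  obtain ⟨RA, hRA, injA, imA⟩ := exists_representatives (f ω₀) A
  obtain ⟨RB, hRB, injB, imB⟩ := exists_representatives (f ω₀) B
  have repA := fun ω hω => representatives_of_ker hRA (kA ω₀ hω₀ ω hω) injA imA
  have repB := fun ω hω => representatives_of_ker hRB (kB ω₀ hω₀ ω hω) injB imB
  let E : Ω → Finset ℕ := fun ω => RB.filter fun y => f ω y ∈ RA.image (f ω)
  have cardU : ∀ ω ∈ S, ∀ Y ⊆ RB, #((RA ∪ Y).image (f ω)) + #(Y ∩ E ω) = #RA + #Y := by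
    intro ω hω Y hY
    have h1 : #((Y ∩ E ω).image (f ω)) = #(Y ∩ E ω) :=
      card_image_of_injOn ((repB ω hω).1.mono (coe_subset.2 (inter_subset_left.trans hY)))
    have h2 : (Y ∩ E ω).image (f ω) = RA.image (f ω) ∩ Y.image (f ω) := by
      ext a
      simp only [E, mem_image, mem_inter, mem_filter]
      constructor
      · rintro ⟨y, ⟨hy, _, x, hx, hxy⟩, rfl⟩
        exact ⟨⟨x, hx, hxy⟩, y, hy, rfl⟩
      · rintro ⟨⟨x, hx, rfl⟩, y, hy, hxy⟩
        exact ⟨y, ⟨hy, hY hy, x, hx, hxy.symm⟩, hxy⟩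
    rw [image_union, ← h1, h2, card_union_add_card_inter,
      card_image_of_injOn (repA ω hω).1,
      card_image_of_injOn ((repB ω hω).1.mono (coe_subset.2 hY))]
  have hE : Learns orc S (fun _ => 4 * 2 ^ 2 ^ (i + 1) / 2 ^ (i + 1)) E := by
    refine learns_subset (fun ω _ => filter_subset _ _) (fun Y hY => ?_)
      ((card_le_card hRB).trans hB)
    refine (hq (RA ∪ Y) (union_subset_union hRA (hY.trans hRB))).determines ?_
    intro ω hω ω' hω' he
    have h1 := cardU ω hω Y hY
    have h2 := cardU ω' hω' Y hY
    rw [he] at h1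
    exact Nat.add_left_cancel (h1.trans h2.symm)
  refine (hE.bind (c' := fun ω => 32 * 2 ^ 2 ^ (i + 1) / 2 ^ (i + 1) +
        16 * (#(A.image (f ω)) + #(B.image (f ω)) - #((A ∪ B).image (f ω))))
        fun D => ?_).mono_cost ?_
  · by_cases hD : D ⊆ RB
    -- A set outside `RB` cannot be the result of the first stage, so no world remains.
    swap
    · refine learns_of_const ?_ ?_ <;>
      · rintro ω ⟨_, rfl⟩
        exact absurd (filter_subset _ _) hD
    have h1 := learns_partners (orc := orc) (S := {ω | ω ∈ S ∧ D = E ω}) (f := f) (R := RA) (i := i)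
      ((card_le_card hRA).trans hA) (fun ω hω => (repA ω hω.1).1) D
      (hq.mono (Set.sep_subset S _) (union_subset_union hRA (hD.trans hRB)))
      (fun ω hω => (repB ω hω.1).1.mono (coe_subset.2 hD)) (by
        rintro ω ⟨_, rfl⟩ a ha
        obtain ⟨y, hy, rfl⟩ := mem_image.1 ha
        exact (mem_filter.1 hy).2)
    refine (h1.determines ?_).mono_cost ?_
    · rintro ω ⟨hω, hDω⟩ ω' ⟨hω', hDω'⟩ he
      refine labelKer_union_eq hRA hRB (kA ω hω ω' hω') (kB ω hω ω' hω') (repA ω hω).2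
        (repB ω hω).2 fun x hx y hy => ?_
      by_cases hyD : y ∈ D
      · have := Finset.ext_iff.1 he (x, y)
        simpa [hx, hyD] using this
      · have h3 : ∀ ω, D = E ω → ¬ f ω x = f ω y := by
          rintro ω rfl hxy
          exact hyD (mem_filter.2 ⟨hy, mem_image.2 ⟨x, hx, hxy⟩⟩)
        exact iff_of_false (h3 ω hDω) (h3 ω' hDω')
    · rintro ω ⟨hω, rfl⟩
      have h2 := cardU ω hω RB subset_rfl
      rw [inter_eq_right.2 (filter_subset _ _ : E ω ⊆ RB)] at h2
      rw [image_union, ← (repA ω hω).2, ← (repB ω hω).2, ← image_union,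
        card_image_of_injOn (repA ω hω).1, card_image_of_injOn (repB ω hω).1]
      have h3 : (#((RA ∪ RB).image (f ω)) : ℝ) + #(E ω) = #RA + #RB := by exact_mod_cast h2
      -- The overhead `16 * 2 ^ 2 ^ i` of the incomplete block is absorbed; this raises the
      -- coefficient from 4 to 36.
      have h4 : (2 : ℝ) ^ 2 ^ i ≤ 2 * 2 ^ 2 ^ (i + 1) / 2 ^ (i + 1) := by
        rw [le_div_iff₀ (by positivity)]
        have h5 : (2 : ℝ) ^ i ≤ 2 ^ 2 ^ i :=
          pow_le_pow_right₀ (by norm_num) Nat.lt_two_pow_self.le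
        calc (2 : ℝ) ^ 2 ^ i * 2 ^ (i + 1) = 2 * (2 ^ 2 ^ i * 2 ^ i) := by ring
          _ ≤ 2 * (2 ^ 2 ^ i * 2 ^ 2 ^ i) := by gcongr
          _ = 2 * 2 ^ 2 ^ (i + 1) := by rw [← pow_add]; congr 2; ring
      have h6 : (32 : ℝ) * 2 ^ 2 ^ (i + 1) / 2 ^ (i + 1) =
        16 * (2 * 2 ^ 2 ^ (i + 1) / 2 ^ (i + 1)) := by ring
      linarith
  · intro ω _
    have h6 : (36 : ℝ) * 2 ^ 2 ^ (i + 1) / 2 ^ (i + 1) =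
      4 * 2 ^ 2 ^ (i + 1) / 2 ^ (i + 1) + 32 * 2 ^ 2 ^ (i + 1) / 2 ^ (i + 1) := by ring
    linarith

/-- Kernels on sets of at most `2 ^ 2 ^ j` elements can be learned with `a * 2 ^ 2 ^ j` queries and
16 more for every element whose label is not new. -/
def LearnsChunks (orc : Ω → Finset ℕ → ℕ) (f : Ω → ℕ → ℕ) (j : ℕ) (a : ℝ) : Prop :=
  ∀ (S : Set Ω) (W : Finset ℕ), #W ≤ 2 ^ 2 ^ j → CountsLabels orc S f W →
    Learns orc S (fun ω => a * 2 ^ 2 ^ j + 16 * (#W - #(W.image (f ω))))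
      fun ω => labelKer (f ω) W

/-- One block is split off and merged at a time. The surpluses of elements over labels in the two
pieces and the labels lost by merging add up to `#W - #(W.image (f ω))`, so the amortized term does
not grow. -/
theorem LearnsChunks.merge {i : ℕ} {a : ℝ} (h : LearnsChunks orc f (i + 1) a) (t : ℕ)
    (S : Set Ω) (W : Finset ℕ) (hW : #W ≤ 2 ^ 2 ^ (i + 2)) (ht : #W ≤ t * 2 ^ 2 ^ (i + 1))
    (hq : CountsLabels orc S f W) :
    Learns orc S (fun ω => t * ((a + 36 / 2 ^ (i + 1)) * 2 ^ 2 ^ (i + 1)) +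
        16 * (#W - #(W.image (f ω))))
      fun ω => labelKer (f ω) W := by
  induction t generalizing S W with
  | zero =>
    have : W = ∅ := by simpa using ht
    subst this
    exact learns_of_const (by simp [labelKer]) (by simp)
  | succ t ih =>
    obtain ⟨B, hBW, hB⟩ := exists_subset_card_eq (min_le_left #W (2 ^ 2 ^ (i + 1)))
    have hsd : W \ B ⊆ W := sdiff_subset
    have hcard := card_sdiff_add_card_eq_card hBW
    have hAt : #(W \ B) ≤ t * 2 ^ 2 ^ (i + 1) := by
      rw [add_mul] at ht
      omega
    have h1 := ih S (W \ B) ((card_le_card hsd).trans hW) hAt (hq.mono subset_rfl hsd)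
    have hAB : (W \ B) ∪ B = W := sdiff_union_of_subset hBW
    have h2 : ∀ kA kB, Learns orc
        {ω | ω ∈ {ω | ω ∈ S ∧ kA = labelKer (f ω) (W \ B)} ∧ kB = labelKer (f ω) B}
        (fun ω => 36 * 2 ^ 2 ^ (i + 1) / 2 ^ (i + 1) +
          16 * (#((W \ B).image (f ω)) + #(B.image (f ω)) - #(W.image (f ω))))
        fun ω => labelKer (f ω) W := by
      intro kA kB
      have h2 := learns_ker_union (orc := orc) (f := f) (A := W \ B) (B := B) (i := i)
        (S := {ω | ω ∈ {ω | ω ∈ S ∧ kA = labelKer (f ω) (W \ B)} ∧ kB = labelKer (f ω) B})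
        (hAB.symm ▸ hq.mono (fun ω hω => hω.1.1) subset_rfl)
        ((card_le_card hsd).trans hW) (hB.le.trans (min_le_right _ _))
        (fun ω hω ω' hω' => hω.1.2.symm.trans hω'.1.2)
        (fun ω hω ω' hω' => hω.2.symm.trans hω'.2)
      rwa [hAB] at h2
    refine (h1.bind fun kA => Learnable.bind (h _ B (hB.le.trans (min_le_right _ _))
      (hq.mono (Set.sep_subset S _) hBW)) (h2 kA)).mono_cost ?_
    · intro ω _
      have h3 : (#(W \ B) : ℝ) + #B = #W := by exact_mod_cast hcard
      rw [← h3]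
      push_cast
      have h4 : (36 : ℝ) * 2 ^ 2 ^ (i + 1) / 2 ^ (i + 1) =
        36 / 2 ^ (i + 1) * 2 ^ 2 ^ (i + 1) := by ring
      linarith

/-- Passing from `2 ^ 2 ^ (i + 1)` to its square adds `36 / 2 ^ (i + 1)` to the coefficient. The
coefficient `40 - 72 / 2 ^ (i + 1)` solves this recursion with initial value 4, and it stays below
40. -/
theorem learnsChunks (orc : Ω → Finset ℕ → ℕ) (f : Ω → ℕ → ℕ) (i : ℕ) :
    LearnsChunks orc f (i + 1) (40 - 72 / 2 ^ (i + 1)) := by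
  induction i with
  | zero =>
    intro S W hW hq
    -- At most 4 elements: asking all ordered pairs costs at most `16 = 4 * 2 ^ 2 ^ 1`.
    refine hq.learns_ker_sq.mono_cost fun ω _ => ?_
    have h1 : (#(W.image (f ω)) : ℝ) ≤ #W := by exact_mod_cast card_image_le
    have h2 : (#W : ℝ) ≤ 4 := by exact_mod_cast hW
    norm_num
    nlinarith [(Nat.cast_nonneg #W : (0 : ℝ) ≤ #W)]
  | succ i ih =>
    intro S W hW hq
    have hsq : 2 ^ 2 ^ (i + 2) = 2 ^ 2 ^ (i + 1) * 2 ^ 2 ^ (i + 1) := by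
      rw [← pow_add]
      congr 1
      ring
    refine (ih.merge (2 ^ 2 ^ (i + 1)) S W hW (hW.trans hsq.le) hq).mono_cost fun ω _ => ?_
    have hsq' : (2 : ℝ) ^ 2 ^ (i + 1 + 1) = 2 ^ 2 ^ (i + 1) * 2 ^ 2 ^ (i + 1) := by
      exact_mod_cast hsq
    rw [hsq']
    push_cast
    apply le_of_eq
    rw [pow_succ 2 (i + 1)]
    field_simp
    ring

/-- The partition of `W` into the fibres of a labelling can be learned with linearly many queries
for the number of labels on a subset. -/
theorem CountsLabels.learns_ker {W : Finset ℕ} (h : CountsLabels orc S f W) :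
    Learns orc S (fun _ => 96 * (#W : ℝ)) fun ω => labelKer (f ω) W := by
  rcases le_or_gt #W 4 with h4 | h4
  · refine h.learns_ker_sq.mono_cost fun ω _ => ?_
    have h2 : (#W : ℝ) ≤ 4 := by exact_mod_cast h4
    nlinarith [(Nat.cast_nonneg #W : (0 : ℝ) ≤ #W)]
  have hex : ∃ i, #W < 2 ^ 2 ^ (i + 2) := by
    refine ⟨#W, ?_⟩
    calc #W < 2 ^ #W := Nat.lt_two_pow_self
      _ ≤ 2 ^ 2 ^ (#W + 2) := by
        gcongr
        · norm_num
        · exact Nat.lt_two_pow_self.le.trans (Nat.pow_le_pow_right (by norm_num) (by omega))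
  classical
  -- Rounding `#W` up to a double power could nearly square it. Blocks of the largest such size not
  -- above `#W` are merged instead, and their total capacity is at most `2 * #W`.
  obtain ⟨i, hi, hmin⟩ : ∃ i, #W < 2 ^ 2 ^ (i + 2) ∧ 2 ^ 2 ^ (i + 1) ≤ #W := by
    refine ⟨Nat.find hex, Nat.find_spec hex, ?_⟩
    rcases hf : Nat.find hex with _ | k
    · simpa using h4.le
    · exact not_lt.1 (Nat.find_min hex (hf ▸ Nat.lt_succ_self k))
  have hpos : 0 < 2 ^ 2 ^ (i + 1) := by positivity
  refine ((learnsChunks orc f i).merge (#W / 2 ^ 2 ^ (i + 1) + 1) S W hi.le ?_ h).mono_cost ?_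
  · rw [mul_comm]
    exact (Nat.lt_mul_div_succ _ hpos).le
  · intro ω _
    have h1 : ((#W / 2 ^ 2 ^ (i + 1) + 1 : ℕ) : ℝ) * 2 ^ 2 ^ (i + 1) ≤ 2 * #W := by
      have : (#W / 2 ^ 2 ^ (i + 1) + 1) * 2 ^ 2 ^ (i + 1) ≤ 2 * #W := by
        have := Nat.div_mul_le_self #W (2 ^ 2 ^ (i + 1))
        rw [add_mul]
        omega
      exact_mod_cast this
    have h2 : (40 : ℝ) - 72 / 2 ^ (i + 1) + 36 / 2 ^ (i + 1) ≤ 40 := by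
      have : (0 : ℝ) ≤ 36 / 2 ^ (i + 1) := by positivity
      have e : (72 : ℝ) / 2 ^ (i + 1) = 2 * (36 / 2 ^ (i + 1)) := by ring
      linarith
    have h3 : (0 : ℝ) ≤ #(W.image (f ω)) := by positivity
    have h5 : ((#W / 2 ^ 2 ^ (i + 1) + 1 : ℕ) : ℝ) *
        ((40 - 72 / 2 ^ (i + 1) + 36 / 2 ^ (i + 1)) * 2 ^ 2 ^ (i + 1)) ≤ 2 * #W * 40 := by
      calc _ = (((#W / 2 ^ 2 ^ (i + 1) + 1 : ℕ) : ℝ) * 2 ^ 2 ^ (i + 1)) *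
            (40 - 72 / 2 ^ (i + 1) + 36 / 2 ^ (i + 1)) := by ring
        _ ≤ (((#W / 2 ^ 2 ^ (i + 1) + 1 : ℕ) : ℝ) * 2 ^ 2 ^ (i + 1)) * 40 := by gcongr
        _ ≤ _ := by gcongr
    linarith

end

/-! ### Overlap queries and transversals -/

/-- The number of elements of `S` with label `i`. -/
def labelCount (f : ℕ → ℕ) (S : Finset ℕ) (i : ℕ) : ℕ :=
  #{v ∈ S | f v = i}

/-- The sum over the labels of the smaller one of the two counts. -/
def labelOverlap (n : ℕ) (f : ℕ → ℕ) (X Y : Finset ℕ) : ℕ :=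
  ∑ i ∈ range n, min (labelCount f X i) (labelCount f Y i)

theorem labelOverlap_comm (n : ℕ) (f : ℕ → ℕ) (X Y : Finset ℕ) :
    labelOverlap n f X Y = labelOverlap n f Y X :=
  sum_congr rfl fun _ _ => min_comm _ _

theorem labelCount_pos {f : ℕ → ℕ} {S : Finset ℕ} {i : ℕ} :
    0 < labelCount f S i ↔ i ∈ S.image f := by
  simp [labelCount, card_pos, filter_nonempty_iff]

theorem labelOverlap_of_injOn {n : ℕ} {f : ℕ → ℕ} {X Y : Finset ℕ} (hX : ∀ x ∈ X, f x < n)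
    (hinj : Set.InjOn f X) : labelOverlap n f X Y = #(X.image f ∩ Y.image f) := by
  have h1 : ∀ i, labelCount f X i ≤ 1 := by
    intro i
    refine card_le_one.2 fun x hx y hy => ?_
    rw [mem_filter] at hx hy
    exact hinj (mem_coe.2 hx.1) (mem_coe.2 hy.1) (hx.2.trans hy.2.symm)
  have h2 : X.image f ∩ Y.image f = (range n).filter fun i => i ∈ X.image f ∩ Y.image f := by
    refine (Finset.ext fun i => ?_)
    rw [mem_filter, mem_range]
    refine ⟨fun h => ⟨?_, h⟩, fun h => h.2⟩
    obtain ⟨x, hx, rfl⟩ := mem_image.1 (mem_inter.1 h).1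
    exact hX x hx
  rw [h2, card_filter]
  refine sum_congr rfl fun i _ => ?_
  have hx := labelCount_pos (f := f) (S := X) (i := i)
  have hy := labelCount_pos (f := f) (S := Y) (i := i)
  have := h1 i
  split_ifs with h
  · rw [mem_inter] at h
    have := hx.2 h.1
    have := hy.2 h.2
    omega
  · rw [mem_inter, not_and_or] at h
    rcases h with h | h
    · rw [← hx] at h
      omega
    · rw [← hy] at h
      omega

section

variable {Ω : Type} {orc : Ω → Finset ℕ → ℕ} {S : Set Ω} {f : Ω → ℕ → ℕ}

/-- Binary search for an element of `G ω`. -/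
theorem learnable_search {G : Ω → Finset ℕ} (d : ℕ) (S : Set Ω) (X : Finset ℕ)
    (h : ∀ Y ⊆ X, Learns orc S (fun _ => 1) fun ω => if (Y ∩ G ω).Nonempty then 1 else 0)
    (hne : ∀ ω ∈ S, (X ∩ G ω).Nonempty) (hX : #X ≤ 2 ^ d) :
    Learnable orc S (fun _ => (d : ℝ)) fun ω x => x ∈ X ∩ G ω := by
  induction d generalizing S X with
  | zero =>
    rcases X.eq_empty_or_nonempty with rfl | ⟨x, hx⟩
    · exact learnable_pure 0 (fun ω hω => by simpa using hne ω hω) (by simp)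
    · refine learnable_pure x (fun ω hω => ?_) (by simp)
      obtain ⟨y, hy⟩ := hne ω hω
      have := card_le_one.1 (by simpa using hX) x hx y (mem_inter.1 hy).1
      exact this ▸ hy
  | succ d ih =>
    obtain ⟨Y, hYX, hY⟩ := exists_subset_card_eq (min_le_left #X (2 ^ d))
    have hcard := card_sdiff_add_card_eq_card hYX
    refine ((h Y hYX).bind (c' := fun _ => (d : ℝ)) fun a => ?_).mono_cost
      (by intro ω _; push_cast; linarith)
    by_cases ha : a = 1
    · refine (ih {ω | ω ∈ S ∧ a = if (Y ∩ G ω).Nonempty then 1 else 0} Y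
        (fun Z hZ => (h Z (hZ.trans hYX)).mono_set (Set.sep_subset S _)) ?_
        (hY.le.trans (min_le_right _ _))).mono subset_rfl (fun _ _ => le_rfl) ?_
      · rintro ω ⟨_, hω⟩
        by_contra hc
        simp [hc, ha] at hω
      · exact fun ω _ x hx => inter_subset_inter_right hYX hx
    · refine (ih {ω | ω ∈ S ∧ a = if (Y ∩ G ω).Nonempty then 1 else 0} (X \ Y)
        (fun Z hZ => (h Z (hZ.trans sdiff_subset)).mono_set (Set.sep_subset S _)) ?_
        (by rw [pow_succ] at hX; omega)).mono subset_rfl (fun _ _ => le_rfl) ?_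
      · rintro ω ⟨hω, hωa⟩
        obtain ⟨x, hx⟩ := hne ω hω
        rw [mem_inter] at hx
        refine ⟨x, mem_inter.2 ⟨mem_sdiff.2 ⟨hx.1, fun hxY => ha ?_⟩, hx.2⟩⟩
        rw [hωa, if_pos ⟨x, mem_inter.2 ⟨hxY, hx.2⟩⟩]
      · exact fun ω _ x hx => inter_subset_inter_right sdiff_subset hx

/-- `P` pairs elements of `B` and of `E` with equal labels, one pair for every label on `E`. -/
structure IsTransversal (f : ℕ → ℕ) (B E : Finset ℕ) (P : Finset (ℕ × ℕ)) : Prop where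
  fst_subset : P.image Prod.fst ⊆ B
  snd_subset : P.image Prod.snd ⊆ E
  label_eq : ∀ p ∈ P, f p.1 = f p.2
  injOn : Set.InjOn (fun p => f p.2) (P : Set (ℕ × ℕ))
  image_snd : (P.image Prod.snd).image f = E.image f

namespace IsTransversal

variable {g : ℕ → ℕ} {B E : Finset ℕ} {P : Finset (ℕ × ℕ)}

theorem image_fst (h : IsTransversal g B E P) : (P.image Prod.fst).image g = E.image g := by
  rw [← h.image_snd, image_image, image_image]
  exact image_congr fun p hp => h.label_eq p hp

theorem injOn_snd (h : IsTransversal g B E P) : Set.InjOn g (P.image Prod.snd : Finset ℕ) := by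
  intro x hx y hy hxy
  obtain ⟨p, hp, rfl⟩ := mem_image.1 (mem_coe.1 hx)
  obtain ⟨q, hq, rfl⟩ := mem_image.1 (mem_coe.1 hy)
  rw [h.injOn hp hq hxy]

theorem injOn_fst (h : IsTransversal g B E P) : Set.InjOn g (P.image Prod.fst : Finset ℕ) := by
  intro x hx y hy hxy
  obtain ⟨p, hp, rfl⟩ := mem_image.1 (mem_coe.1 hx)
  obtain ⟨q, hq, rfl⟩ := mem_image.1 (mem_coe.1 hy)
  rw [h.label_eq p hp, h.label_eq q hq] at hxy
  rw [h.injOn hp hq hxy]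

theorem insert (h : IsTransversal g B E P) {x e : ℕ} (hx : x ∈ B) (hxe : g x = g e)
    (he : g e ∉ E.image g) : IsTransversal g B (insert e E) (insert (x, e) P) where
  fst_subset := by
    rw [image_insert]
    exact insert_subset hx h.fst_subset
  snd_subset := by
    rw [image_insert]
    exact insert_subset_insert e h.snd_subset
  label_eq := by
    intro p hp
    rcases mem_insert.1 hp with rfl | hp
    · exact hxe
    · exact h.label_eq p hp
  injOn := by
    have key : ∀ p ∈ P, g p.2 ≠ g e := by
      intro p hp hpe
      exact he (hpe ▸ mem_image_of_mem g (h.snd_subset (mem_image_of_mem _ hp)))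
    intro p hp q hq hpq
    simp only [coe_insert, Set.mem_insert_iff, mem_coe] at hp hq
    rcases hp with rfl | hp <;> rcases hq with rfl | hq
    · rfl
    · exact absurd hpq.symm (key q hq)
    · exact absurd hpq (key p hp)
    · exact h.injOn hp hq hpq
  image_snd := by simp [image_insert, h.image_snd]

theorem insert_of_mem (h : IsTransversal g B E P) {e : ℕ} (he : g e ∈ E.image g) :
    IsTransversal g B (Insert.insert e E) P where
  fst_subset := h.fst_subset
  snd_subset := h.snd_subset.trans (subset_insert e E)
  label_eq := h.label_eq
  injOn := h.injOn
  image_snd := by rw [image_insert, insert_eq_of_mem he, h.image_snd]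

end IsTransversal

/-- The first components found so far carry all labels seen on `E`, so their overlap with `{e}`
tells whether `e` has a new label. Only a new label requires a binary search in `B`, of depth `d`.
-/
theorem learnable_transversal {n d : ℕ} {B : Finset ℕ} (hB : ∀ ω ∈ S, ∀ x ∈ B, f ω x < n)
    (hd : #B ≤ 2 ^ d) (E : Finset ℕ)
    (hq : ∀ X ⊆ B, ∀ Y ⊆ E, Learns orc S (fun _ => 1) fun ω => labelOverlap n (f ω) X Y)
    (hEB : ∀ ω ∈ S, E.image (f ω) ⊆ B.image (f ω)) :
    Learnable orc S (fun ω => #E + #(E.image (f ω)) * d) fun ω P => IsTransversal (f ω) B E P := by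
  induction E using Finset.induction_on with
  | empty => exact learnable_pure ∅ (fun ω _ => ⟨by simp, by simp, by simp, by simp, by simp⟩) (by simp)
  | insert e E he ih =>
    have h1 := ih (fun X hX Y hY => hq X hX Y (hY.trans (subset_insert e E)))
      fun ω hω => (image_subset_image (subset_insert e E)).trans (hEB ω hω)
    refine (h1.bind (c' := fun ω => 1 +
      ((#((insert e E).image (f ω)) : ℝ) - #(E.image (f ω))) * d) fun P => ?_).mono_cost ?_
    -- If no world admits the result `P`, any tree will do; otherwise a single world shows that the
    -- next query lies in `B`.
    · rcases Set.eq_empty_or_nonempty {ω | ω ∈ S ∧ IsTransversal (f ω) B E P} with h0 | ⟨ω₀, hω₀⟩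
      · rw [h0]
        exact learnable_pure ∅ (by simp) (by simp)
      have hPB := hω₀.2.fst_subset
      have hover : ∀ ω ∈ S, IsTransversal (f ω) B E P →
          labelOverlap n (f ω) (P.image Prod.fst) {e} = if f ω e ∈ E.image (f ω) then 1 else 0 := by
        intro ω hω hP
        rw [labelOverlap_of_injOn (fun x hx => hB ω hω x (hPB hx)) hP.injOn_fst, hP.image_fst,
          image_singleton]
        split_ifs with h
        · rw [inter_singleton_of_mem h, card_singleton]
        · rw [inter_singleton_of_notMem h, card_empty]
      refine Learnable.bind ((hq _ hPB {e} (by simp)).mono_set (Set.sep_subset S _)) fun a => ?_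
      by_cases ha : a = 1
      · refine learnable_pure P ?_ ?_
        · rintro ω ⟨⟨hω, hP⟩, haω⟩
          beta_reduce at haω
          rw [hover ω hω hP, ha] at haω
          refine hP.insert_of_mem ?_
          by_contra hc
          simp [hc] at haω
        · intro ω _
          have : (#(E.image (f ω)) : ℝ) ≤ #((insert e E).image (f ω)) := by
            exact_mod_cast card_le_card (image_subset_image (subset_insert e E))
          exact mul_nonneg (sub_nonneg.2 this) (Nat.cast_nonneg d)
      · have hnew : ∀ ω, (ω ∈ S ∧ IsTransversal (f ω) B E P) ∧
            a = labelOverlap n (f ω) (P.image Prod.fst) {e} → f ω e ∉ E.image (f ω) := by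
          rintro ω ⟨⟨hω, hP⟩, haω⟩ hc
          rw [hover ω hω hP, if_pos hc] at haω
          exact ha haω
        have h2 := learnable_search (orc := orc) (G := fun ω => B.filter fun x => f ω x = f ω e) d
          {ω | ω ∈ {ω | ω ∈ S ∧ IsTransversal (f ω) B E P} ∧
            a = labelOverlap n (f ω) (P.image Prod.fst) {e}} B ?_ ?_ hd
        · refine (h2.bind (c' := fun _ => 0) (post' := fun ω P => IsTransversal (f ω) B (insert e E) P)
            fun x => learnable_pure (insert (x, e) P) ?_ (by simp)).mono_cost ?_
          · rintro ω ⟨hω, hx⟩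
            rw [mem_inter, mem_filter] at hx
            exact hω.1.2.insert hx.1 hx.2.2 (hnew ω hω)
          · intro ω hω
            have h3 := hnew ω hω
            rw [image_insert, card_insert_of_notMem h3]
            push_cast
            linarith
        · intro Y hY
          refine ((hq Y hY {e} (by simp)).mono_set (fun ω hω => hω.1.1)).congr fun ω hω => ?_
          rw [labelOverlap_comm, labelOverlap_of_injOn _ (by simp), image_singleton]
          · have : (Y ∩ B.filter fun x => f ω x = f ω e).Nonempty ↔ f ω e ∈ Y.image (f ω) := by
              constructor
              · rintro ⟨x, hx⟩
                simp only [mem_inter, mem_filter] at hx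
                exact mem_image.2 ⟨x, hx.1, hx.2.2⟩
              · intro hx
                obtain ⟨x, hx, hxe⟩ := mem_image.1 hx
                exact ⟨x, mem_inter.2 ⟨hx, mem_filter.2 ⟨hY hx, hxe⟩⟩⟩
            rw [if_congr this rfl rfl]
            split_ifs with h
            · rw [singleton_inter_of_mem h, card_singleton]
            · rw [singleton_inter_of_notMem h, card_empty]
          · intro x hx
            rw [mem_singleton.1 hx]
            obtain ⟨y, hy, hye⟩ := mem_image.1 (hEB ω hω.1.1 (mem_image_of_mem _ (mem_insert_self e E)))
            exact hye ▸ hB ω hω.1.1 y hy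
        · intro ω hω
          obtain ⟨y, hy, hye⟩ := mem_image.1 (hEB ω hω.1.1 (mem_image_of_mem _ (mem_insert_self e E)))
          exact ⟨y, mem_inter.2 ⟨hy, mem_filter.2 ⟨hy, hye⟩⟩⟩
    · intro ω _
      rw [card_insert_of_notMem he]
      push_cast
      linarith

/-- Each side of a transversal carries every label once, so overlap with it counts the labels on
subsets of the opposite side. Both kernels are thus learned in linear time, and the pairs of the
transversal glue them. -/
theorem learns_ker_of_overlap {n d : ℕ} {B E : Finset ℕ} (hB : ∀ ω ∈ S, ∀ x ∈ B, f ω x < n)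
    (hd : #B ≤ 2 ^ d)
    (hq : ∀ X ⊆ B, ∀ Y ⊆ E, Learns orc S (fun _ => 1) fun ω => labelOverlap n (f ω) X Y)
    (hEB : ∀ ω ∈ S, E.image (f ω) = B.image (f ω)) :
    Learns orc S (fun ω => (#E + #(E.image (f ω)) * d) + (96 * #B + 96 * #E))
      fun ω => labelKer (f ω) (B ∪ E) := by
  refine (learnable_transversal hB hd E hq fun ω hω => (hEB ω hω).subset).bind fun P => ?_
  rcases Set.eq_empty_or_nonempty {ω | ω ∈ S ∧ IsTransversal (f ω) B E P} with h0 | ⟨ω₀, hω₀⟩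
  · rw [h0]
    exact learns_of_const (by simp) (by simp)
  have hPB := hω₀.2.fst_subset
  have hPE := hω₀.2.snd_subset
  have cE : CountsLabels orc {ω | ω ∈ S ∧ IsTransversal (f ω) B E P} f E := by
    intro Y hY
    refine ((hq _ hPB Y hY).mono_set (Set.sep_subset S _)).congr fun ω hω => ?_
    rw [labelOverlap_of_injOn (fun x hx => hB ω hω.1 x (hPB hx)) hω.2.injOn_fst, hω.2.image_fst,
      inter_eq_right.2 (image_subset_image hY)]
  have cB : CountsLabels orc {ω | ω ∈ S ∧ IsTransversal (f ω) B E P} f B := by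
    intro X hX
    refine ((hq X hX _ hPE).mono_set (Set.sep_subset S _)).congr fun ω hω => ?_
    rw [labelOverlap_comm, labelOverlap_of_injOn _ hω.2.injOn_snd, hω.2.image_snd, hEB ω hω.1,
      inter_eq_right.2 (image_subset_image hX)]
    intro x hx
    obtain ⟨y, hy, hyx⟩ := mem_image.1 ((hEB ω hω.1).subset (mem_image_of_mem _ (hPE hx)))
    exact hyx ▸ hB ω hω.1 y hy
  refine cB.learns_ker.bind fun kB => ((cE.mono (Set.sep_subset _ _) subset_rfl).learns_ker).determines ?_
  rintro ω ⟨⟨hω, hP⟩, hk⟩ ω' ⟨⟨hω', hP'⟩, hk'⟩ he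
  refine labelKer_union_eq hPB hPE (hk.symm.trans hk') he (hP.image_fst.trans (hEB ω hω))
    hP.image_snd fun x hx y hy => ?_
  obtain ⟨p, hp, rfl⟩ := mem_image.1 hx
  obtain ⟨q, hq, rfl⟩ := mem_image.1 hy
  rw [hP.label_eq p hp, hP'.label_eq p hp]
  exact (hP.injOn.eq_iff hp hq).trans (hP'.injOn.eq_iff hp hq).symm

end

/-! ### Labelled worlds and the greedy basis -/

/-- The labels of the elements, and the capacities of the labels. -/
abbrev LabelledWorld : Type := (ℕ → ℕ) × (ℕ → ℕ)

namespace LabelledWorld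

/-- The rank function on subsets of `{0, …, n - 1}`. -/
def rank (n : ℕ) (ω : LabelledWorld) (S : Finset ℕ) : ℕ :=
  ∑ i ∈ range n, min (labelCount ω.1 (S ∩ range n) i) (ω.2 i)

/-- The label of an element is the least element with this label, and the capacities are those of a
general partition matroid on `{0, …, n - 1}`. -/
def Valid (n : ℕ) (ω : LabelledWorld) : Prop :=
  (∀ v < n, ω.1 v ≤ v ∧ ω.1 (ω.1 v) = ω.1 v) ∧
    ∀ i < n, ω.1 i = i → 1 ≤ ω.2 i ∧ ω.2 i < labelCount ω.1 (range n) i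

/-- The parts in the order of their least elements, with their capacities. -/
def output (n : ℕ) (ω : LabelledWorld) : LearnerOutput :=
  ((List.range n).filter fun i => ω.1 i = i).map fun i =>
    ((List.range n).filter fun v => ω.1 v = i, ω.2 i)

/-- The basis that is found greedily. -/
def basis (n : ℕ) (ω : LabelledWorld) : Finset ℕ :=
  (range n).filter fun t => labelCount ω.1 (range t) (ω.1 t) < ω.2 (ω.1 t)

variable {n : ℕ} {ω ω' : LabelledWorld}

theorem Valid.lt (h : ω.Valid n) {v : ℕ} (hv : v < n) : ω.1 v < n :=
  (h.1 v hv).1.trans_lt hv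

theorem basis_subset : ω.basis n ⊆ range n :=
  filter_subset _ _

theorem labelCount_insert (f : ℕ → ℕ) {S : Finset ℕ} {v : ℕ} (hv : v ∉ S) (i : ℕ) :
    labelCount f (insert v S) i = labelCount f S i + if f v = i then 1 else 0 := by
  unfold labelCount
  rw [filter_insert]
  split_ifs with h
  · rw [card_insert_of_notMem (by simp [hv])]
  · rfl

theorem rank_range_succ (h : ω.Valid n) {t : ℕ} (ht : t < n) :
    ω.rank n (range (t + 1)) = ω.rank n (range t) + if t ∈ ω.basis n then 1 else 0 := by
  have h1 : range (t + 1) ∩ range n = insert t (range t ∩ range n) := by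
    ext v
    simp only [mem_inter, mem_range, mem_insert]
    omega
  have h2 : range t ∩ range n = range t := inter_eq_left.2 (range_mono ht.le)
  have h3 : (if t ∈ ω.basis n then 1 else 0) =
      ∑ i ∈ range n, if ω.1 t = i then (if t ∈ ω.basis n then 1 else 0) else 0 := by
    rw [sum_ite_eq, if_pos (mem_range.2 (h.lt ht))]
  unfold rank
  rw [h1, h2, h3, ← sum_add_distrib]
  refine sum_congr rfl fun i _ => ?_
  rw [labelCount_insert _ (by simp)]
  by_cases hi : ω.1 t = i
  · subst hi
    simp only [basis, mem_filter, mem_range, ht, true_and, if_true]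
    split_ifs <;> omega
  · simp [hi]

theorem labelCount_basis_inter_range {t : ℕ} (ht : t ≤ n) (i : ℕ) :
    labelCount ω.1 (ω.basis n ∩ range t) i = min (labelCount ω.1 (range t) i) (ω.2 i) := by
  induction t with
  | zero => simp [labelCount]
  | succ t ih =>
    have ih := ih (by omega)
    rw [range_add_one, labelCount_insert _ (by simp)]
    by_cases hb : t ∈ ω.basis n
    · rw [inter_insert_of_mem hb, labelCount_insert _ (by simp), ih]
      have := (mem_filter.1 hb).2
      split_ifs with hi
      · subst hi
        omega
      · omega
    · rw [inter_insert_of_notMem hb, ih]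
      split_ifs with hi
      · subst hi
        simp only [basis, mem_filter, mem_range, not_and] at hb
        have := hb (by omega)
        omega
      · omega

theorem labelCount_basis (i : ℕ) :
    labelCount ω.1 (ω.basis n) i = min (labelCount ω.1 (range n) i) (ω.2 i) := by
  rw [← labelCount_basis_inter_range le_rfl, inter_eq_left.2 basis_subset]

theorem labelCount_union {f : ℕ → ℕ} {X Y : Finset ℕ} (h : Disjoint X Y) (i : ℕ) :
    labelCount f (X ∪ Y) i = labelCount f X i + labelCount f Y i := by
  unfold labelCount
  rw [filter_union, card_union_of_disjoint (disjoint_filter_filter h)]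

theorem sum_labelCount {f : ℕ → ℕ} {X : Finset ℕ} (h : ∀ x ∈ X, f x < n) :
    ∑ i ∈ range n, labelCount f X i = #X :=
  (card_eq_sum_card_fiberwise fun x hx => mem_coe.2 (mem_range.2 (h x hx))).symm

/-- For each label, `X` frees some capacity and `Y` fills at most that much. The identity holds
label by label, because the basis either uses the full capacity or contains all elements with this
label. -/
theorem rank_exchange (h : ω.Valid n) {X Y : Finset ℕ} (hX : X ⊆ ω.basis n)
    (hY : Y ⊆ range n \ ω.basis n) :
    ω.rank n ((ω.basis n \ X) ∪ Y) + #X = #(ω.basis n) + labelOverlap n ω.1 X Y := by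
  have hYn : Y ⊆ range n := hY.trans sdiff_subset
  have hlt : ∀ Z ⊆ ω.basis n, ∀ x ∈ Z, ω.1 x < n := fun Z hZ x hx =>
    h.lt (mem_range.1 (basis_subset (hZ hx)))
  have hdis : Disjoint (ω.basis n) Y :=
    disjoint_right.2 fun y hy => (mem_sdiff.1 (hY hy)).2
  rw [← sum_labelCount (hlt X hX), ← sum_labelCount (hlt _ subset_rfl), labelOverlap, rank,
    ← sum_add_distrib, ← sum_add_distrib]
  refine sum_congr rfl fun i _ => ?_
  rw [inter_eq_left.2 (union_subset (sdiff_subset.trans basis_subset) hYn),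
    labelCount_union (hdis.mono_left sdiff_subset)]
  have h1 := labelCount_basis (n := n) (ω := ω) i
  have h2 := labelCount_union (f := ω.1) (sdiff_disjoint (s := X) (t := ω.basis n)) i
  rw [sdiff_union_of_subset hX] at h2
  have h3 : labelCount ω.1 (ω.basis n) i + labelCount ω.1 Y i ≤ labelCount ω.1 (range n) i := by
    rw [← labelCount_union hdis]
    exact card_le_card (filter_subset_filter _ (union_subset basis_subset hYn))
  omega

theorem rank_range (h : ω.Valid n) : ω.rank n (range n) = #(ω.basis n) := by
  rw [← sum_labelCount fun x hx => h.lt (mem_range.1 (basis_subset hx))]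
  refine sum_congr rfl fun i _ => ?_
  rw [inter_self, labelCount_basis]

/-- This is where positivity of the capacities and strictness of `r_i < |P_i|` are needed. -/
theorem Valid.label_mem (h : ω.Valid n) {v : ℕ} (hv : v < n) :
    ω.1 v ∈ (ω.basis n).image ω.1 ∧ ω.1 v ∈ (range n \ ω.basis n).image ω.1 := by
  have h1 := h.2 (ω.1 v) (h.lt hv) (h.1 v hv).2
  have h2 := labelCount_basis (n := n) (ω := ω) (ω.1 v)
  have h3 := labelCount_union (f := ω.1) (sdiff_disjoint (s := ω.basis n) (t := range n)) (ω.1 v)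
  rw [sdiff_union_of_subset basis_subset] at h3
  rw [← labelCount_pos, ← labelCount_pos]
  omega

theorem image_basis (h : ω.Valid n) : (ω.basis n).image ω.1 = (range n).image ω.1 := by
  refine (image_subset_image basis_subset).antisymm fun i hi => ?_
  obtain ⟨v, hv, rfl⟩ := mem_image.1 hi
  exact (h.label_mem (mem_range.1 hv)).1

theorem image_sdiff_basis (h : ω.Valid n) :
    (range n \ ω.basis n).image ω.1 = (range n).image ω.1 := by
  refine (image_subset_image sdiff_subset).antisymm fun i hi => ?_
  obtain ⟨v, hv, rfl⟩ := mem_image.1 hi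
  exact (h.label_mem (mem_range.1 hv)).2

theorem learns_basis :
    Learns (rank n) {ω | ω.Valid n} (fun _ => (n : ℝ)) (basis n) := by
  refine ((learns_finset (range n) (fun t ω => ω.rank n (range (t + 1))) fun t _ =>
    learns_query _).determines ?_).mono_cost (by simp)
  intro ω hω ω' hω' he
  have h1 : ∀ t ≤ n, ω.rank n (range t) = ω'.rank n (range t) := by
    intro t ht
    rcases t with _ | t
    · simp [rank, labelCount]
    · have := congrFun he t
      simpa [show t < n by omega] using this
  ext t
  by_cases ht : t < n
  · have h2 := rank_range_succ hω ht
    have h3 := rank_range_succ hω' ht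
    rw [h1 _ ht, h1 t ht.le, h3] at h2
    by_cases hb : t ∈ ω.basis n <;> by_cases hb' : t ∈ ω'.basis n <;> simp_all
  · exact iff_of_false (fun h => ht (mem_range.1 (basis_subset h)))
      fun h => ht (mem_range.1 (basis_subset h))

/-- Labels are least elements of their classes, so the kernel determines the labels themselves. -/
theorem labels_eq (h : ω.Valid n) (h' : ω'.Valid n)
    (hk : labelKer ω.1 (range n) = labelKer ω'.1 (range n)) {v : ℕ} (hv : v < n) :
    ω.1 v = ω'.1 v := by
  have half : ∀ {ω ω' : LabelledWorld}, ω.Valid n → ω'.Valid n →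
      labelKer ω.1 (range n) = labelKer ω'.1 (range n) → ω'.1 v ≤ ω.1 v := by
    intro ω ω' h h' hk
    rw [labelKer_eq_iff] at hk
    have := (hk _ (mem_range.2 (h.lt hv)) _ (mem_range.2 hv)).1 (h.1 v hv).2
    exact this ▸ (h'.1 _ (h.lt hv)).1
  exact (half h' h hk.symm).antisymm (half h h' hk)

/-- The capacity of a part is the number of basis elements in it. -/
theorem output_eq (h : ω.Valid n) (h' : ω'.Valid n) (hb : ω.basis n = ω'.basis n)
    (hk : labelKer ω.1 (range n) = labelKer ω'.1 (range n)) : ω.output n = ω'.output n := by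
  have hl : ∀ v < n, ω.1 v = ω'.1 v := fun v hv => labels_eq h h' hk hv
  unfold output
  have e1 : ((List.range n).filter fun i => ω.1 i = i) =
      (List.range n).filter fun i => ω'.1 i = i :=
    List.filter_congr fun i hi => by rw [hl i (List.mem_range.1 hi)]
  rw [e1]
  refine List.map_congr_left fun i hi => ?_
  simp only [List.mem_filter, List.mem_range, decide_eq_true_eq] at hi
  have e2 : ((List.range n).filter fun v => ω.1 v = i) =
      (List.range n).filter fun v => ω'.1 v = i :=
    List.filter_congr fun v hv => by rw [hl v (List.mem_range.1 hv)]
  have e3 : labelCount ω.1 (ω.basis n) i = labelCount ω'.1 (ω'.basis n) i := by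
    rw [← hb]
    exact congrArg card (filter_congr fun v hv => by rw [hl v (mem_range.1 (basis_subset hv))])
  rw [labelCount_basis, labelCount_basis, min_eq_right (h.2 i hi.1 ((hl i hi.1).trans hi.2)).2.le,
    min_eq_right (h'.2 i hi.1 hi.2).2.le] at e3
  rw [e2, e3]

/-- The basis costs `n` queries and its size is the rank, whence the depth of the binary searches.
The other linear terms, `#E + 96 * #B + 96 * #E`, are at most `97 * n`. -/
theorem learns_output (n : ℕ) :
    Learns (rank n) {ω | ω.Valid n}
      (fun ω => 98 * n + #((range n).image ω.1) * Nat.clog 2 (ω.rank n (range n))) (output n) := by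
  refine (learns_basis.bind (c' := fun ω => 97 * n +
    #((range n).image ω.1) * Nat.clog 2 (ω.rank n (range n))) fun B => ?_).mono_cost ?_
  · rcases Set.eq_empty_or_nonempty {ω : LabelledWorld | ω ∈ {ω | ω.Valid n} ∧ B = ω.basis n} with
      h0 | ⟨ω₀, hω₀⟩
    · rw [h0]
      exact learns_of_const (by simp) (by simp)
    have hB : B ⊆ range n := hω₀.2 ▸ basis_subset
    have h1 := learns_ker_of_overlap (orc := rank n) (f := Prod.fst) (n := n) (B := B)
      (S := {ω : LabelledWorld | ω ∈ {ω | ω.Valid n} ∧ B = ω.basis n}) (E := range n \ B)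
      (d := Nat.clog 2 #B) (fun ω hω x hx => hω.1.lt (mem_range.1 (hB hx)))
      (Nat.le_pow_clog (by norm_num) _) ?_ ?_
    · rw [union_sdiff_of_subset hB] at h1
      refine (h1.determines ?_).mono_cost ?_
      · rintro ω ⟨hω, hωB⟩ ω' ⟨hω', hωB'⟩ hk
        exact output_eq hω hω' (hωB.symm.trans hωB') hk
      · rintro ω ⟨hω, rfl⟩
        have h2 : (#(range n \ ω.basis n) : ℝ) + #(ω.basis n) = n := by
          have := card_sdiff_add_card_eq_card (basis_subset (n := n) (ω := ω))
          rw [card_range] at this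
          exact_mod_cast this
        have h3 : (0 : ℝ) ≤ #(ω.basis n) := Nat.cast_nonneg _
        rw [image_sdiff_basis hω, rank_range hω]
        linarith
    · intro X hX Y hY
      refine (learns_query ((B \ X) ∪ Y)).determines ?_
      rintro ω ⟨hω, rfl⟩ ω' ⟨hω', hB'⟩ he
      have h2 := rank_exchange hω hX hY
      have h3 := rank_exchange hω' (hB' ▸ hX) (hB' ▸ hY)
      rw [← hB', ← he] at h3
      exact Nat.add_left_cancel (h2.symm.trans h3)
    · rintro ω ⟨hω, rfl⟩
      rw [image_sdiff_basis hω, image_basis hω]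
  · intro ω _
    linarith

end LabelledWorld

/-! ### From decision trees to finite tables -/

namespace QueryTree

variable {α : Type}

/-- The tree that is left after the answers in the list. -/
def after : QueryTree α → List ℕ → QueryTree α
  | t, [] => t
  | pure a, _ :: _ => pure a
  | query _ k, x :: h => after (k x) h

/-- The first move of a tree. -/
noncomputable def root : QueryTree α → List ℕ ⊕ α
  | pure a => Sum.inr a
  | query S _ => Sum.inl S.toList

theorem after_pure (a : α) (h : List ℕ) : (pure a).after h = pure a := by
  cases h <;> rfl

theorem after_append (t : QueryTree α) (h h' : List ℕ) :
    t.after (h ++ h') = (t.after h).after h' := by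
  induction h generalizing t with
  | nil => cases t <;> rfl
  | cons x h ih =>
    cases t with
    | pure a => simp [after, after_pure]
    | query S k => exact ih (k x)

end QueryTree

/-- Continue the list of answers according to the rule `mv`. -/
def advance {α : Type} (o : List ℕ → ℕ) (mv : List ℕ → List ℕ ⊕ α) (h : List ℕ) : List ℕ :=
  Sum.casesOn (mv h) (fun q => h ++ [o q]) fun _ => h

section advance

variable {α : Type} {o : List ℕ → ℕ} {mv mv' : List ℕ → List ℕ ⊕ α} {h : List ℕ}

theorem advance_inl {q : List ℕ} (hq : mv h = Sum.inl q) : advance o mv h = h ++ [o q] := by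
  simp [advance, hq]

theorem advance_inr {a : α} (ha : mv h = Sum.inr a) : advance o mv h = h := by
  simp [advance, ha]

theorem advance_iterate_congr {D : ℕ}
    (heq : ∀ i < D, mv ((advance o mv)^[i] h) = mv' ((advance o mv)^[i] h)) :
    ∀ i ≤ D, (advance o mv')^[i] h = (advance o mv)^[i] h := by
  intro i hi
  induction i with
  | zero => rfl
  | succ i ih =>
    rw [Function.iterate_succ_apply', Function.iterate_succ_apply', ih (by omega)]
    simp only [advance, heq i (by omega)]

/-- After halting, `advance` leaves the history fixed, so any number of iterations from the cost
upwards shows the same result. -/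
theorem QueryTree.root_after_iterate (t : QueryTree α) (o : Finset ℕ → ℕ) (u : QueryTree α)
    (h : List ℕ) (hu : t.after h = u) (m : ℕ) (hm : u.cost o ≤ m) :
    (t.after ((advance (fun q => o q.toFinset) fun h => (t.after h).root)^[m] h)).root =
      Sum.inr (u.run o) := by
  induction u generalizing h m with
  | pure a =>
    have hfix : advance (fun q => o q.toFinset) (fun h => (t.after h).root) h = h :=
      advance_inr (a := a) (by rw [hu]; rfl)
    rw [Function.iterate_fixed hfix, hu]
    rfl
  | query S k ih =>
    rw [QueryTree.cost] at hm
    obtain ⟨m, rfl⟩ : ∃ m', m = m' + 1 := ⟨m - 1, by omega⟩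
    rw [Function.iterate_succ_apply,
      advance_inl (q := S.toList) (by rw [hu]; rfl), Finset.toList_toFinset]
    refine ih (o S) _ ?_ m (by omega)
    rw [QueryTree.after_append, hu]
    cases hk : k (o S) <;> simp [QueryTree.after, hk]

theorem QueryAlgorithm.exists_runsTo {A : QueryAlgorithm} {n : ℕ} {orc : Finset ℕ → ℕ}
    {out : LearnerOutput} (m : ℕ) (h : List ℕ)
    (hout : A (n, (advance (fun q => orc q.toFinset) fun h => A (n, h))^[m] h) = Sum.inr out) :
    ∃ m' ≤ m, A.RunsTo n orc h m' out := by
  induction m generalizing h with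
  | zero => exact ⟨0, le_rfl, .halt h out hout⟩
  | succ m ih =>
    rw [Function.iterate_succ_apply] at hout
    obtain ⟨m', hm', hr⟩ := ih _ hout
    cases hA : A (n, h) with
    | inl q =>
      rw [advance_inl hA] at hr
      exact ⟨m' + 1, by omega, .query h q m' out hA hr⟩
    | inr a =>
      rw [advance_inr hA] at hr
      exact ⟨m', by omega, hr⟩

end advance

/-- A finite strategy: a list of histories, with the move in each of them. -/
abbrev StrategyTable : Type := List (List ℕ × (List ℕ ⊕ LearnerOutput))

/-- The move after the answers `h`; the output is empty outside of the table. -/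
def StrategyTable.move (T : StrategyTable) (h : List ℕ) : List ℕ ⊕ LearnerOutput :=
  (T.lookup h).getD (Sum.inr [])

/-- The labels and the capacities that are given by the digits of two numbers to the base
`n + 1`. -/
def digitWorld (x : ℕ × ℕ × ℕ) : LabelledWorld :=
  (fun v => x.2.1 / (x.1 + 1) ^ v % (x.1 + 1), fun v => x.2.2 / (x.1 + 1) ^ v % (x.1 + 1))

theorem exists_digits (N n : ℕ) (g : ℕ → ℕ) (hg : ∀ v < n, g v < N) :
    ∃ a < N ^ n, ∀ v < n, a / N ^ v % N = g v := by
  induction n with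
  | zero => exact ⟨0, by simp, by simp⟩
  | succ n ih =>
    obtain ⟨a, ha, h⟩ := ih fun v hv => hg v (by omega)
    have hn := hg n (by omega)
    refine ⟨a + g n * N ^ n, ?_, fun v hv => ?_⟩
    · calc a + g n * N ^ n < (g n + 1) * N ^ n := by rw [add_mul]; omega
        _ ≤ N * N ^ n := Nat.mul_le_mul_right _ hn
        _ = N ^ (n + 1) := by ring
    · have hN : 0 < N := by omega
      rcases Nat.lt_succ_iff_lt_or_eq.1 hv with hv | rfl
      · obtain ⟨d, rfl⟩ := Nat.exists_eq_add_of_lt hv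
        have : a + g (v + d + 1) * N ^ (v + d + 1) =
            a + N ^ v * (N * (g (v + d + 1) * N ^ d)) := by ring
        rw [this, Nat.add_mul_div_left _ _ (by positivity), Nat.add_mul_mod_self_left, h v hv]
      · rw [Nat.add_mul_div_right _ _ (by positivity), Nat.div_eq_of_lt ha, zero_add,
          Nat.mod_eq_of_lt hn]

/-- The rank of the set of the elements of a list. -/
def listRank (n : ℕ) (ω : LabelledWorld) (q : List ℕ) : ℕ :=
  ((List.range n).map fun i =>
    min (((List.range n).filter fun v => v ∈ q ∧ ω.1 v = i).length) (ω.2 i)).sum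

theorem listRank_eq (n : ℕ) (ω : LabelledWorld) (q : List ℕ) :
    listRank n ω q = ω.rank n q.toFinset := by
  have h : ∀ i, labelCount ω.1 (q.toFinset ∩ range n) i =
      ((List.range n).filter fun v => v ∈ q ∧ ω.1 v = i).length := by
    intro i
    have : {v ∈ q.toFinset ∩ range n | ω.1 v = i} = (range n).filter fun v => v ∈ q ∧ ω.1 v = i := by
      ext v
      simp only [mem_filter, mem_inter, List.mem_toFinset, mem_range]
      tauto
    rw [labelCount, this]
    rfl
  simp only [LabelledWorld.rank, h]
  rfl

/-- The number of labels of a valid world. -/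
def numRoots (n : ℕ) (ω : LabelledWorld) : ℕ :=
  ((List.range n).filter fun i => ω.1 i = i).length

theorem numRoots_eq {n : ℕ} {ω : LabelledWorld} (h : ω.Valid n) :
    numRoots n ω = #((range n).image ω.1) := by
  have : (range n).image ω.1 = (range n).filter fun i => ω.1 i = i := by
    ext i
    simp only [mem_image, mem_filter, mem_range]
    constructor
    · rintro ⟨v, hv, rfl⟩
      exact ⟨h.lt hv, (h.1 v hv).2⟩
    · exact fun hi => ⟨i, hi.1, hi.2⟩
  rw [this]
  rfl

/-- The table gives the right output in the world `x`, within the budget for the number of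
queries. -/
def StrategyTable.Solves (T : StrategyTable) (x : ℕ × ℕ × ℕ) : Prop :=
  ∃ l < x.1 + 1, 2 ^ l ≤ 2 * listRank x.1 (digitWorld x) (List.range x.1) + 1 ∧
    T.move ((advance (listRank x.1 (digitWorld x)) T.move)^[
      98 * x.1 + numRoots x.1 (digitWorld x) * l] []) = Sum.inr ((digitWorld x).output x.1)

/-- The table is correct for all general partition matroids on `{0, …, n - 1}`. -/
def StrategyTable.Correct (T : StrategyTable) (n : ℕ) : Prop :=
  ∀ a < (n + 1) ^ n, ∀ b < (n + 1) ^ n, (digitWorld (n, a, b)).Valid n → T.Solves (n, a, b)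

/-- Only finitely many histories arise within the budget from worlds coded by digits, so the tree
can be tabulated on them. -/
theorem exists_correct_table (n : ℕ) : ∃ T : StrategyTable, T.Correct n := by
  obtain ⟨t, ht⟩ := LabelledWorld.learns_output n
  let o : ℕ × ℕ → List ℕ → ℕ := fun p => listRank n (digitWorld (n, p))
  let mv : List ℕ → List ℕ ⊕ LearnerOutput := fun h => (t.after h).root
  let hist : (ℕ × ℕ) × ℕ → List ℕ := fun p => (advance (o p.1) mv)^[p.2] []
  -- A bound for all budgets, since the number of labels and the rounded logarithm of the rank are
  -- at most `n`.
  let D := 98 * n + n * n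
  let K : Finset (List ℕ) :=
    (((range ((n + 1) ^ n)) ×ˢ (range ((n + 1) ^ n))) ×ˢ range (D + 1)).image hist
  let T : StrategyTable := K.toList.map fun h => (h, mv h)
  have hT : ∀ h ∈ K, T.move h = mv h := by
    intro h hh
    rw [StrategyTable.move, List.lookup_graph _ (mem_toList.2 hh), Option.getD_some]
  refine ⟨T, fun a ha b hb hv => ?_⟩
  set ω := digitWorld (n, a, b) with hω
  obtain ⟨hrun, hcost⟩ := ht ω hv
  have hrank : listRank n ω (List.range n) = ω.rank n (range n) := by
    rw [listRank_eq, List.toFinset_range]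
  have hroots := numRoots_eq hv
  have hrn : ω.rank n (range n) ≤ n := by
    rw [LabelledWorld.rank_range hv]
    simpa using card_le_card (LabelledWorld.basis_subset (n := n) (ω := ω))
  have hl : Nat.clog 2 (ω.rank n (range n)) ≤ n :=
    Nat.clog_le_of_le_pow (hrn.trans Nat.lt_two_pow_self.le)
  have hk : numRoots n ω ≤ n := by
    rw [hroots]
    simpa using card_image_le (s := range n) (f := ω.1)
  -- In `Solves`, the bound `2 ^ l ≤ 2 * r + 1` replaces the logarithm by a condition that is easy
  -- to decide; the summand 1 is for rank 0.
  refine ⟨Nat.clog 2 (ω.rank n (range n)), Nat.lt_succ_of_le hl, ?_, ?_⟩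
  · simp only
    rw [← hω, hrank]
    rcases Nat.lt_or_ge 1 (ω.rank n (range n)) with h1 | h1
    · have h2 := Nat.pow_pred_clog_lt_self (b := 2) (by norm_num) h1
      have h3 := Nat.clog_pos (b := 2) (by norm_num) h1
      obtain ⟨c, hc⟩ := Nat.exists_eq_add_of_lt h3
      rw [hc] at h2 ⊢
      simp only [zero_add, Nat.pred_succ, pow_succ] at h2 ⊢
      omega
    · rw [Nat.clog_of_right_le_one h1]
      omega
  · simp only
    rw [← hω]
    set m := 98 * n + numRoots n ω * Nat.clog 2 (ω.rank n (range n)) with hm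
    have hmD : m ≤ D := Nat.add_le_add_left (Nat.mul_le_mul hk hl) _
    have hK : ∀ i ≤ D, (advance (listRank n ω) mv)^[i] [] ∈ K := fun i hi =>
      mem_image.2 ⟨((a, b), i), by simp [ha, hb]; omega, rfl⟩
    have hcongr := advance_iterate_congr (o := listRank n ω) (mv := mv) (mv' := T.move) (h := [])
      (D := D) fun i hi => (hT _ (hK i hi.le)).symm
    rw [hcongr m hmD, hT _ (hK m hmD), ← hrun]
    have ho : listRank n ω = fun q => ω.rank n q.toFinset := funext (listRank_eq n ω)
    rw [ho]
    refine t.root_after_iterate (ω.rank n) t [] (by cases t <;> rfl) m ?_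
    beta_reduce at hcost
    rw [← hroots] at hcost
    exact_mod_cast hcost

/-! ### Matroids as labelled worlds -/

section Representation

variable {n : ℕ}

/-- The labels and capacities on `{0, …, n - 1}` are those of the matroid. -/
def Represents (ω : LabelledWorld) (M : GenPartitionMatroid (range n)) : Prop :=
  ∀ v < n, IsLeast (M.partition.part v : Set ℕ) (ω.1 v) ∧ ω.2 v = M.cap (M.partition.part v)

namespace Represents

variable {ω : LabelledWorld} {M : GenPartitionMatroid (range n)}

theorem part_label (h : Represents ω M) {v : ℕ} (hv : v < n) :
    M.partition.part (ω.1 v) = M.partition.part v :=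
  M.partition.part_eq_of_mem (M.partition.part_mem.2 (mem_range.2 hv)) (h v hv).1.1

theorem label_le (h : Represents ω M) {v : ℕ} (hv : v < n) : ω.1 v ≤ v :=
  (h v hv).1.2 (M.partition.mem_part (mem_range.2 hv))

theorem label_eq_iff (h : Represents ω M) {v w : ℕ} (hv : v < n) (hw : w < n) :
    ω.1 v = ω.1 w ↔ M.partition.part v = M.partition.part w := by
  constructor
  · intro he
    rw [← h.part_label hv, he, h.part_label hw]
  · intro he
    exact (h v hv).1.unique (he ▸ (h w hw).1)

theorem label_label (h : Represents ω M) {v : ℕ} (hv : v < n) : ω.1 (ω.1 v) = ω.1 v :=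
  (h.label_eq_iff ((h.label_le hv).trans_lt hv) hv).2 (h.part_label hv)

theorem filter_label (h : Represents ω M) {i : ℕ} (hi : i < n) (hr : ω.1 i = i) (S : Finset ℕ) :
    {v ∈ S ∩ range n | ω.1 v = i} = S ∩ M.partition.part i := by
  ext v
  simp only [mem_filter, mem_inter, mem_range]
  constructor
  · rintro ⟨⟨hS, hv⟩, he⟩
    refine ⟨hS, ?_⟩
    rw [← (h.label_eq_iff hv hi).1 (he.trans hr.symm)]
    exact M.partition.mem_part (mem_range.2 hv)
  · rintro ⟨hS, hv⟩
    have hp := M.partition.part_mem.2 (mem_range.2 hi)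
    have hvn : v < n := mem_range.1 (M.partition.le hp hv)
    exact ⟨⟨hS, hvn⟩, ((h.label_eq_iff hvn hi).2 (M.partition.part_eq_of_mem hp hv)).trans hr⟩

/-- The elements that are their own label. -/
def roots (n : ℕ) (ω : LabelledWorld) : Finset ℕ :=
  (range n).filter fun i => ω.1 i = i

theorem injOn_roots (h : Represents ω M) : Set.InjOn M.partition.part (roots n ω) := by
  intro i hi j hj hij
  simp only [roots, mem_coe, mem_filter, mem_range] at hi hj
  rw [← hi.2, ← hj.2]
  exact (h.label_eq_iff hi.1 hj.1).2 hij

theorem image_roots (h : Represents ω M) : (roots n ω).image M.partition.part =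
    M.partition.parts := by
  ext P
  simp only [mem_image, roots, mem_filter, mem_range]
  constructor
  · rintro ⟨i, hi, rfl⟩
    exact M.partition.part_mem.2 (mem_range.2 hi.1)
  · intro hP
    obtain ⟨v, hv⟩ := M.partition.nonempty_of_mem_parts hP
    have hvn : v < n := mem_range.1 (M.partition.le hP hv)
    exact ⟨ω.1 v, ⟨(h.label_le hvn).trans_lt hvn, h.label_label hvn⟩,
      (h.part_label hvn).trans (M.partition.part_eq_of_mem hP hv)⟩

theorem valid (h : Represents ω M) : ω.Valid n := by
  refine ⟨fun v hv => ⟨h.label_le hv, h.label_label hv⟩, fun i hi hr => ?_⟩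
  have hp := M.partition.part_mem.2 (mem_range.2 hi)
  have := h.filter_label hi hr (range n)
  rw [inter_self] at this
  rw [labelCount, this, inter_eq_right.2 (M.partition.le hp), (h i hi).2]
  exact ⟨M.one_le_cap _ hp, M.cap_lt_card _ hp⟩

theorem rank_eq (h : Represents ω M) : ω.rank n = M.rank := by
  funext S
  rw [GenPartitionMatroid.rank, ← h.image_roots, sum_image h.injOn_roots, LabelledWorld.rank]
  refine (sum_subset_zero_on_sdiff (filter_subset _ _) (fun i hi => ?_) fun i hi => ?_).symm
  · simp only [mem_sdiff, mem_filter, not_and, mem_range] at hi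
    have : labelCount ω.1 (S ∩ range n) i = 0 := by
      rw [labelCount, card_eq_zero, filter_eq_empty_iff]
      rintro v hv rfl
      exact hi.2 hi.1 (h.label_label (mem_range.1 (mem_inter.1 hv).2))
    rw [this, Nat.zero_min]
  · simp only [mem_filter, mem_range] at hi
    rw [labelCount, h.filter_label hi.1 hi.2, (h i hi.1).2]

theorem numRoots_eq (h : Represents ω M) : numRoots n ω = M.numParts := by
  rw [GenPartitionMatroid.numParts, ← h.image_roots, card_image_of_injOn h.injOn_roots]
  rfl

theorem describes (h : Represents ω M) : LearnerOutput.Describes (ω.output n) M := by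
  rw [LearnerOutput.Describes, ← h.image_roots, image_val_of_injOn h.injOn_roots,
    LabelledWorld.output, ← Multiset.map_coe, Multiset.map_map, Multiset.map_map]
  refine Multiset.map_congr rfl fun i hi => ?_
  have hi : i < n ∧ ω.1 i = i := by simpa [roots] using hi
  have := h.filter_label hi.1 hi.2 (range n)
  rw [inter_self, inter_eq_right.2 (M.partition.le (M.partition.part_mem.2 (mem_range.2 hi.1)))]
    at this
  refine Prod.ext ?_ (h i hi.1).2
  simp only [Function.comp]
  rw [← this]
  ext v
  simp

end Represents

/-- Least elements of parts and capacities are all at most `n`, hence are digits to the base `n +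
1`. -/
theorem exists_represents (M : GenPartitionMatroid (range n)) :
    ∃ a < (n + 1) ^ n, ∃ b < (n + 1) ^ n, Represents (digitWorld (n, a, b)) M := by
  have hne : ∀ v < n, ∃ i, IsLeast (M.partition.part v : Set ℕ) i := fun v hv =>
    ⟨_, (M.partition.part v).isLeast_min' ⟨v, M.partition.mem_part (mem_range.2 hv)⟩⟩
  choose! g hg using hne
  have hlt : ∀ v < n, ∀ i ∈ M.partition.part v, i < n := fun v hv i hi =>
    mem_range.1 (M.partition.le (M.partition.part_mem.2 (mem_range.2 hv)) hi)
  obtain ⟨a, ha, ha'⟩ := exists_digits (n + 1) n g fun v hv =>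
    (hlt v hv _ (hg v hv).1).trans n.lt_succ_self
  obtain ⟨b, hb, hb'⟩ := exists_digits (n + 1) n (fun v => M.cap (M.partition.part v)) fun v hv => by
    have hp := M.partition.part_mem.2 (mem_range.2 hv)
    have h1 := M.cap_lt_card _ hp
    have h2 := card_le_card (M.partition.le hp)
    rw [card_range] at h2
    omega
  refine ⟨a, ha, b, hb, fun v hv => ⟨?_, hb' v hv⟩⟩
  have he : (digitWorld (n, a, b)).1 v = g v := ha' v hv
  exact he ▸ hg v hv

end Representation

/-! ### Computability of the search for a table -/

section Computability

variable {α β : Type} [Primcodable α] [Primcodable β]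

theorem PrimrecRel.ball_range {R : ℕ → α → Prop} (hR : PrimrecRel R) {g : α → ℕ}
    (hg : Primrec g) : PrimrecPred fun x => ∀ v < g x, R v x :=
  (hR.forall_mem_list.comp (Primrec.list_range.comp hg) Primrec.id).of_eq fun x => by simp

theorem PrimrecRel.bex_range {R : ℕ → α → Prop} (hR : PrimrecRel R) {g : α → ℕ}
    (hg : Primrec g) : PrimrecPred fun x => ∃ v < g x, R v x :=
  (hR.exists_mem_list.comp (Primrec.list_range.comp hg) Primrec.id).of_eq fun x => by simp

theorem PrimrecPred.imp {p q : α → Prop} (hp : PrimrecPred p) (hq : PrimrecPred q) :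
    PrimrecPred fun x => p x → q x :=
  (hp.not.or hq).of_eq fun _ => imp_iff_not_or.symm

theorem Primrec.nat_pow : Primrec₂ fun a b : ℕ => a ^ b :=
  (Primrec.nat_iterate (f := fun p : ℕ × ℕ => p.2) (g := fun _ => 1) (h := fun p x => x * p.1)
    Primrec.snd (Primrec.const 1)
    (Primrec.nat_mul.comp₂ Primrec₂.right (Primrec.fst.comp₂ Primrec₂.left))).of_eq fun p => by
      induction p.2 with
      | zero => rfl
      | succ k ih => exact (Function.iterate_succ_apply' _ _ _).trans (by rw [ih]; exact (pow_succ _ _).symm)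

theorem Primrec.list_sum : Primrec (List.sum : List ℕ → ℕ) :=
  (Primrec.list_foldr (f := id) (g := fun _ => 0) (h := fun _ p => p.1 + p.2) Primrec.id
    (Primrec.const 0) (Primrec.nat_add.comp₂ (Primrec.fst.comp₂ Primrec₂.right)
      (Primrec.snd.comp₂ Primrec₂.right))).of_eq fun _ => rfl

theorem PrimrecRel.mem_list : PrimrecRel fun (v : α) (q : List α) => v ∈ q :=
  (Primrec.eq.exists_mem_list.comp Primrec.snd Primrec.fst).of_eq fun p => by simp

theorem PrimrecRel.filter_range {R : ℕ → α → Prop} [DecidableRel R] (hR : PrimrecRel R)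
    {g : α → ℕ} (hg : Primrec g) : Primrec fun x => (List.range (g x)).filter fun v => R v x :=
  hR.listFilter.comp (Primrec.list_range.comp hg) Primrec.id

theorem primrec_digit {g : α → ℕ} {k : α → ℕ} {l : α → ℕ} (hg : Primrec g) (hk : Primrec k)
    (hl : Primrec l) : Primrec fun x => g x / (k x + 1) ^ l x % (k x + 1) :=
  have hk' := Primrec.succ.comp hk
  Primrec.nat_mod.comp (Primrec.nat_div.comp hg (Primrec.nat_pow.comp hk' hl)) hk'

theorem primrec_label {X : α → ℕ × ℕ × ℕ} {v : α → ℕ} (hX : Primrec X) (hv : Primrec v) :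
    Primrec fun x => (digitWorld (X x)).1 (v x) :=
  primrec_digit (Primrec.fst.comp (Primrec.snd.comp hX)) (Primrec.fst.comp hX) hv

theorem primrec_cap {X : α → ℕ × ℕ × ℕ} {v : α → ℕ} (hX : Primrec X) (hv : Primrec v) :
    Primrec fun x => (digitWorld (X x)).2 (v x) :=
  primrec_digit (Primrec.snd.comp (Primrec.snd.comp hX)) (Primrec.fst.comp hX) hv

theorem primrec_roots : Primrec fun x : ℕ × ℕ × ℕ =>
    (List.range x.1).filter fun i => (digitWorld x).1 i = i :=
  PrimrecRel.filter_range (R := fun i x => (digitWorld x).1 i = i)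
    (Primrec.eq.comp (primrec_label Primrec.snd Primrec.fst) Primrec.fst) Primrec.fst

theorem primrec_fiber : Primrec₂ fun (x : ℕ × ℕ × ℕ) (i : ℕ) =>
    (List.range x.1).filter fun v => (digitWorld x).1 v = i :=
  PrimrecRel.filter_range (α := (ℕ × ℕ × ℕ) × ℕ) (R := fun v p => (digitWorld p.1).1 v = p.2)
    (g := fun p => p.1.1)
    (Primrec.eq.comp (primrec_label (Primrec.fst.comp Primrec.snd) Primrec.fst)
      (Primrec.snd.comp Primrec.snd)) (Primrec.fst.comp Primrec.fst)

theorem primrec_numRoots : Primrec fun x : ℕ × ℕ × ℕ => numRoots x.1 (digitWorld x) :=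
  Primrec.list_length.comp primrec_roots

theorem primrec_output : Primrec fun x : ℕ × ℕ × ℕ => (digitWorld x).output x.1 :=
  Primrec.list_map primrec_roots
    (Primrec.pair primrec_fiber (primrec_cap Primrec.fst Primrec.snd)).to₂

theorem primrec_listRank :
    Primrec₂ fun (x : ℕ × ℕ × ℕ) (q : List ℕ) => listRank x.1 (digitWorld x) q := by
  have hf : Primrec fun y : ((ℕ × ℕ × ℕ) × List ℕ) × ℕ => (List.range y.1.1.1).filter fun v =>
      v ∈ y.1.2 ∧ (digitWorld y.1.1).1 v = y.2 :=
    PrimrecRel.filter_range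
      (R := fun v (y : ((ℕ × ℕ × ℕ) × List ℕ) × ℕ) => v ∈ y.1.2 ∧ (digitWorld y.1.1).1 v = y.2)
      (g := fun y => y.1.1.1)
      (PrimrecPred.and
        (PrimrecRel.mem_list.comp Primrec.fst (Primrec.snd.comp (Primrec.fst.comp Primrec.snd)))
        (Primrec.eq.comp
          (primrec_label (Primrec.fst.comp (Primrec.fst.comp Primrec.snd)) Primrec.fst)
          (Primrec.snd.comp Primrec.snd)))
      (Primrec.fst.comp (Primrec.fst.comp Primrec.fst))
  exact Primrec.list_sum.comp (Primrec.list_map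
    (Primrec.list_range.comp (Primrec.fst.comp Primrec.fst))
    (Primrec.nat_min.comp (Primrec.list_length.comp hf)
      (primrec_cap (Primrec.fst.comp Primrec.fst) Primrec.snd)).to₂)

theorem primrec_valid : PrimrecPred fun x : ℕ × ℕ × ℕ => (digitWorld x).Valid x.1 := by
  refine PrimrecPred.and ?_ ?_
  · refine PrimrecRel.ball_range (α := ℕ × ℕ × ℕ)
      (R := fun v x => (digitWorld x).1 v ≤ v ∧ (digitWorld x).1 ((digitWorld x).1 v) =
        (digitWorld x).1 v) ?_ Primrec.fst
    have hl := primrec_label (Primrec.snd (α := ℕ) (β := ℕ × ℕ × ℕ)) Primrec.fst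
    exact PrimrecPred.and (Primrec.nat_le.comp hl Primrec.fst)
      (Primrec.eq.comp (primrec_label Primrec.snd hl) hl)
  · refine PrimrecRel.ball_range (α := ℕ × ℕ × ℕ)
      (R := fun i x => (digitWorld x).1 i = i → 1 ≤ (digitWorld x).2 i ∧
        (digitWorld x).2 i < labelCount (digitWorld x).1 (range x.1) i) ?_ Primrec.fst
    have hl := primrec_label (Primrec.snd (α := ℕ) (β := ℕ × ℕ × ℕ)) Primrec.fst
    have hc := primrec_cap (Primrec.snd (α := ℕ) (β := ℕ × ℕ × ℕ)) Primrec.fst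
    refine PrimrecPred.imp (Primrec.eq.comp hl Primrec.fst) (PrimrecPred.and
      (Primrec.nat_le.comp (Primrec.const 1) hc) (Primrec.nat_lt.comp hc ?_))
    exact Primrec.list_length.comp (primrec_fiber.comp Primrec.snd Primrec.fst)

theorem primrec_move : Primrec₂ StrategyTable.move :=
  (Primrec.option_getD.comp (Primrec.listLookup.comp Primrec.snd Primrec.fst)
    (Primrec.const (Sum.inr []))).of_eq fun p => by
      -- The lookups use two equality tests on `List ℕ`, which agree because both are lawful.
      rw [StrategyTable.move, lawful_beq_subsingleton instBEqOfDecidableEq List.instBEq]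

theorem primrec_advance : Primrec₂ fun (p : StrategyTable × ℕ × ℕ × ℕ) (h : List ℕ) =>
    advance (listRank p.2.1 (digitWorld p.2)) p.1.move h :=
  Primrec.sumCasesOn
    (primrec_move.comp (Primrec.fst.comp Primrec.fst) Primrec.snd)
    (Primrec.list_concat.comp (Primrec.snd.comp Primrec.fst)
      (primrec_listRank.comp (Primrec.snd.comp (Primrec.fst.comp Primrec.fst)) Primrec.snd)).to₂
    (Primrec.snd.comp Primrec.fst).to₂

theorem primrec_solves :
    PrimrecPred fun p : StrategyTable × ℕ × ℕ × ℕ => p.1.Solves p.2 := by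
  refine PrimrecRel.bex_range (α := StrategyTable × ℕ × ℕ × ℕ)
    (R := fun l p => 2 ^ l ≤ 2 * listRank p.2.1 (digitWorld p.2) (List.range p.2.1) + 1 ∧
      p.1.move ((advance (listRank p.2.1 (digitWorld p.2)) p.1.move)^[
        98 * p.2.1 + numRoots p.2.1 (digitWorld p.2) * l] []) =
          Sum.inr ((digitWorld p.2).output p.2.1)) ?_
    (Primrec.succ.comp (Primrec.fst.comp Primrec.snd))
  have hp : Primrec fun y : ℕ × StrategyTable × ℕ × ℕ × ℕ => y.2 := Primrec.snd
  have hx : Primrec fun y : ℕ × StrategyTable × ℕ × ℕ × ℕ => y.2.2 := Primrec.snd.comp hp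
  have hn : Primrec fun y : ℕ × StrategyTable × ℕ × ℕ × ℕ => y.2.2.1 := Primrec.fst.comp hx
  refine PrimrecPred.and (Primrec.nat_le.comp (Primrec.nat_pow.comp (Primrec.const 2) Primrec.fst)
    (Primrec.succ.comp (Primrec.nat_mul.comp (Primrec.const 2)
      (primrec_listRank.comp hx (Primrec.list_range.comp hn)))))
    (Primrec.eq.comp (primrec_move.comp (Primrec.fst.comp hp) ?_)
      (Primrec.sumInr.comp (primrec_output.comp hx)))
  exact Primrec.nat_iterate
    (Primrec.nat_add.comp (Primrec.nat_mul.comp (Primrec.const 98) hn)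
      (Primrec.nat_mul.comp (primrec_numRoots.comp hx) Primrec.fst))
    (Primrec.const [])
    (primrec_advance.comp₂ (hp.comp₂ Primrec₂.left) Primrec₂.right)

theorem primrec_correct : PrimrecRel StrategyTable.Correct := by
  have hbound : Primrec fun p : StrategyTable × ℕ => (p.2 + 1) ^ p.2 :=
    Primrec.nat_pow.comp (Primrec.succ.comp Primrec.snd) Primrec.snd
  refine PrimrecRel.ball_range (α := StrategyTable × ℕ)
    (R := fun a p => ∀ b < (p.2 + 1) ^ p.2, (digitWorld (p.2, a, b)).Valid p.2 →
      p.1.Solves (p.2, a, b)) ?_ hbound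
  refine PrimrecRel.ball_range (α := ℕ × StrategyTable × ℕ)
    (R := fun b y => (digitWorld (y.2.2, y.1, b)).Valid y.2.2 →
      y.2.1.Solves (y.2.2, y.1, b)) ?_ (hbound.comp Primrec.snd)
  have hy : Primrec fun z : ℕ × ℕ × StrategyTable × ℕ => z.2 := Primrec.snd
  have hT : Primrec fun z : ℕ × ℕ × StrategyTable × ℕ => z.2.2 := Primrec.snd.comp hy
  have hx : Primrec fun z : ℕ × ℕ × StrategyTable × ℕ => (z.2.2.2, z.2.1, z.1) :=
    Primrec.pair (Primrec.snd.comp hT) (Primrec.pair (Primrec.fst.comp hy) Primrec.fst)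
  exact PrimrecPred.imp (primrec_valid.comp hx)
    (primrec_solves.comp (Primrec.pair (Primrec.fst.comp hT) hx))

/-- The table with a given code. -/
def tableOfCode (t : ℕ) : StrategyTable :=
  (Encodable.decode (α := StrategyTable) t).getD []

theorem exists_correct_code (n : ℕ) : ∃ t, (tableOfCode t).Correct n := by
  obtain ⟨T, hT⟩ := exists_correct_table n
  exact ⟨Encodable.encode T, by simpa [tableOfCode] using hT⟩

/-- Correctness of a table is decidable, so that a correct table can be found by unbounded search. -/
theorem exists_computable_correct_table :
    ∃ F : ℕ → StrategyTable, Computable F ∧ ∀ n, (F n).Correct n := by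
  classical
  have htable : Primrec tableOfCode :=
    Primrec.option_getD.comp Primrec.decode (Primrec.const [])
  have hp : ComputablePred fun p : ℕ × ℕ => (tableOfCode p.2).Correct p.1 :=
    ⟨inferInstance,
      (primrec_correct.comp (htable.comp Primrec.snd) Primrec.fst).decide.to_comp⟩
  exact ⟨fun n => tableOfCode (Nat.find (exists_correct_code n)),
    htable.to_comp.comp (Computable.find hp exists_correct_code),
    fun n => Nat.find_spec (exists_correct_code n)⟩

end Computability

/-! ### The final bound -/

/-- Rounding the logarithm costs at most 1 per part, and `k ≤ n`; this raises the constant from 98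
to 99. -/
theorem mul_le_of_two_pow_le {k l n r : ℕ} (hk : k ≤ n) (hl : 2 ^ l ≤ 2 * r + 1) :
    (k * l : ℝ) ≤ n + k * Real.logb 2 r := by
  have hkn : (k : ℝ) ≤ n := by exact_mod_cast hk
  rcases Nat.eq_zero_or_pos r with rfl | hr
  · have : l = 0 := by
      by_contra h
      have := Nat.one_lt_two_pow h
      omega
    simp [this]
  · have h1 : 2 ^ l ≤ 2 * r := by
      rcases l with _ | l
      · simp only [pow_zero]
        omega
      · rw [pow_succ] at *
        omega
    have h2 : (l : ℝ) ≤ 1 + Real.logb 2 r := by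
      have h3 : Real.logb 2 (2 ^ l) ≤ Real.logb 2 (2 * r) :=
        Real.logb_le_logb_of_le (by norm_num) (by positivity) (by exact_mod_cast h1)
      rwa [Real.logb_pow, Real.logb_self_eq_one (by norm_num), mul_one,
        Real.logb_mul (by norm_num) (by positivity), Real.logb_self_eq_one (by norm_num)] at h3
    calc (k * l : ℝ) ≤ k * (1 + Real.logb 2 r) := by gcongr
      _ ≤ n + k * Real.logb 2 r := by linarith

theorem theorem2 :
    ∃ A : QueryAlgorithm, Computable A ∧
      ∃ C : ℝ, ∀ (n : ℕ) (M : GenPartitionMatroid (Finset.range n)),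
        ∃ (m : ℕ) (o : LearnerOutput),
          QueryAlgorithm.RunsTo A n M.rank [] m o ∧
          LearnerOutput.Describes o M ∧
          (m : ℝ) ≤ C * ((n : ℝ) + (M.numParts : ℝ) * Real.logb 2 (M.rank (Finset.range n) : ℝ)) := by
  obtain ⟨F, hF, hcorrect⟩ := exists_computable_correct_table
  refine ⟨fun p => (F p.1).move p.2,
    primrec_move.to_comp.comp (hF.comp Computable.fst) Computable.snd, 99, fun n M => ?_⟩
  obtain ⟨a, ha, b, hb, hM⟩ := exists_represents M
  obtain ⟨l, -, hl, hmove⟩ := hcorrect n a ha b hb hM.valid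
  simp only at hl hmove
  rw [listRank_eq, List.toFinset_range, hM.rank_eq] at hl
  rw [funext (listRank_eq n _), hM.rank_eq, hM.numRoots_eq] at hmove
  obtain ⟨m, hm, hrun⟩ := QueryAlgorithm.exists_runsTo (A := fun p => (F p.1).move p.2) (n := n)
    (orc := M.rank) _ [] hmove
  refine ⟨m, _, hrun, hM.describes, ?_⟩
  have hk : M.numParts ≤ n := by
    rw [← hM.numRoots_eq, numRoots_eq hM.valid]
    simpa using card_image_le (s := range n) (f := (digitWorld (n, a, b)).1)
  have h1 : (m : ℝ) ≤ 98 * n + M.numParts * l := by exact_mod_cast hm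
  have h2 := mul_le_of_two_pow_le hk hl
  have h3 : 0 ≤ (M.numParts : ℝ) * Real.logb 2 (M.rank (range n)) := by
    refine mul_nonneg (Nat.cast_nonneg _) ?_
    rcases Nat.eq_zero_or_pos (M.rank (range n)) with h | h
    · simp [h]
    · exact Real.logb_nonneg (by norm_num) (by exact_mod_cast h)
  linarith
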